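/- Let $g\ge 2$ be an integer and let $V=\mathbb{Q}[x_1,x_2,\ldots]$, graded by $\deg x_i=i$; write $\partial_i=\partial/\partial x_i$ and $x_1^{[a]}=x_1^a/a!$ for $a\ge 0$, $x_1^{[a]}=0$ for $a<0$. Put $$D=-g\partial_1+\frac12\sum_{m,n\ge 1}\binom{m+n}{m}x_{m+n-1}\partial_m\partial_n,\qquad D_k=\frac1{k!}\sum_{n_1,\ldots,n_k\ge 1}\frac{(n_1+\ldots+n_k)!}{n_1!\cdots n_k!}\,x_{n_1+\ldots+n_k-1}\,\partial_{n_1}\cdots\partial_{n_k}\quad(k\ge 2).$$ Let $I_g\subset V$ be the linear span of all homogeneous polynomials of degree $>g$ and of all polynomials $D^d(x_1^{m_1}\cdots x_k^{m_k})$ with $d\ge 0$, $m_1+2m_2+\ldots+km_k=g$, $m_1<g$. Let $S:V\to V$ be the linear operator such that, for all $n\ge 0$, $k\ge 0$ and $n_1,\ldots,n_k>1$, $$(-1)^nS(x_1^{[n]}x_{n_1}\cdots x_{n_k})=\sum_{\{1,\ldots,k\}=I_1\sqcup\ldots\sqcup I_m}b(I_1)\cdots b(I_m)\,x_1^{[g-n-m-\sum_i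 n_i]}\,x_{d(I_1)}\cdots x_{d(I_m)},$$ where the sum is over the unordered partitions of $\{1,\ldots,k\}$ into nonempty subsets (for $k=0$ the only one is the empty partition, $m=0$), $b(I)=(\sum_{i\in I}n_i)!/\prod_{i\in I}n_i!$ and $d(I)=\sum_{i\in I}n_i-|I|+1$. Then: (a) $D=D_2-g\partial_1$, and $[D_k,D]=0$ on $V$ for every $k\ge 3$. (b) $I_g$ is an ideal of $V$, so that $R_g^{\mathrm{Jac}}=V/I_g$ is a commutative ring; $S$ descends to an invertible linear operator (again denoted $S$) on $R_g^{\mathrm{Jac}}$, and $D_k$ descends to a linear operator on $R_g^{\mathrm{Jac}}$ for every $k\ge 3$. (c) Let $p_k$ be the class of $x_k$ in $R_g^{\mathrm{Jac}}$. For every $k\ge 2$ and every $F\in R_g^{\mathrm{Jac}}$ one has $$S(p_k\cdot S^{-1}F)=D_{k+1}(F).$$ -/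

import Mathlib

open scoped Nat

namespace JacTaut

noncomputable section

/-- The polynomial ring `ℚ[x₁, x₂, …]`. -/
abbrev V : Type := MvPolynomial ℕ+ ℚ

/-- The variable `x_n`, for a natural number `n ≥ 1` (the value at `n = 0` is never used). -/
def x (n : ℕ) : V := MvPolynomial.X n.toPNat'

/-- The iterated partial derivative `∂_{n₁} … ∂_{n_k}`, for a list `[n₁, …, n_k]`. -/
def partials (l : List ℕ+) : Module.End ℚ V :=
  (l.map fun n => (MvPolynomial.pderiv n : Derivation ℚ V V).toLinearMap).prod

theorem exists_of_coeff_partials_ne_zero (F : V) (l : List ℕ+) :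
    ∀ m : ℕ+ →₀ ℕ, (partials l F).coeff m ≠ 0 →
      ∃ m' : ℕ+ →₀ ℕ, F.coeff m' ≠ 0 ∧ m ≤ m' ∧ ∀ i ∈ l, 0 < m' i := by
  induction l with
  | nil => intro m hm; exact ⟨m, by simpa [partials] using hm, le_rfl, by simp⟩
  | cons a l ih =>
    intro m hm
    have h1 : partials (a :: l) F = MvPolynomial.pderiv a (partials l F) := by
      simp [partials]
    rw [h1, MvPolynomial.coeff_pderiv] at hm
    obtain ⟨m', h, hle, hpos⟩ := ih _ (left_ne_zero_of_mul hm)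
    refine ⟨m', h, le_trans (by simp) hle, ?_⟩
    intro i hi
    rcases List.mem_cons.mp hi with rfl | hi
    · have := hle i
      simp at this
      omega
    · exact hpos i hi

theorem mem_vars_of_partials_ne_zero {F : V} {l : List ℕ+} (h : partials l F ≠ 0) :
    ∀ i ∈ l, i ∈ F.vars := by
  obtain ⟨m, hm⟩ := MvPolynomial.ne_zero_iff.mp h
  obtain ⟨m', h1, -, h2⟩ := exists_of_coeff_partials_ne_zero F l m hm
  intro i hi
  exact (MvPolynomial.mem_vars_iff_mem_support i).mpr
    ⟨m', MvPolynomial.mem_support_iff.mpr h1, Finsupp.mem_support_iff.mpr (h2 i hi).ne'⟩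

/-- Only finitely many of the derivatives `∂_{n₁} … ∂_{n_k} F` are nonzero. -/
theorem finite_support_diffOp {k : ℕ} (c : (Fin k → ℕ+) → V) (F : V) :
    (Function.support fun n : Fin k → ℕ+ => c n * partials (List.ofFn n) F).Finite := by
  refine (Fintype.piFinset fun _ : Fin k => F.vars).finite_toSet.subset ?_
  intro n hn
  have h : partials (List.ofFn n) F ≠ 0 := right_ne_zero_of_mul hn
  simp only [Finset.mem_coe, Fintype.mem_piFinset]
  exact fun i => mem_vars_of_partials_ne_zero h _ (by simp [List.mem_ofFn])

/-- The differential operator `∑_{n₁, …, n_k ≥ 1} c(n₁, …, n_k) ∂_{n₁} … ∂_{n_k}` with polynomial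
coefficients; applied to a given polynomial, the sum has only finitely many nonzero terms. -/
def diffOp {k : ℕ} (c : (Fin k → ℕ+) → V) : Module.End ℚ V where
  toFun F := ∑ᶠ n : Fin k → ℕ+, c n * partials (List.ofFn n) F
  map_add' F G := by
    rw [← finsum_add_distrib (finite_support_diffOp c F) (finite_support_diffOp c G)]
    simp only [map_add, mul_add]
  map_smul' a F := by
    rw [RingHom.id_apply, smul_finsum' a (finite_support_diffOp c F)]
    simp only [map_smul, mul_smul_comm]

/-- `D_k = (1/k!) ∑_{n₁, …, n_k ≥ 1} (n₁ + … + n_k)! / (n₁! … n_k!)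
  x_{n₁ + … + n_k - 1} ∂_{n₁} … ∂_{n_k}` (used for `k ≥ 2`). -/
def Dk (k : ℕ) : Module.End ℚ V :=
  (1 / (k ! : ℚ)) • diffOp fun n : Fin k → ℕ+ =>
    (((∑ i, (n i : ℕ)) ! : ℚ) / ∏ i, ((n i : ℕ) ! : ℚ)) • x ((∑ i, (n i : ℕ)) - 1)

/-- The partial derivative `∂₁`. -/
def partialOne : Module.End ℚ V := (MvPolynomial.pderiv 1 : Derivation ℚ V V).toLinearMap

/-- `D = -g ∂₁ + (1/2) ∑_{m, n ≥ 1} binom(m + n, m) x_{m + n - 1} ∂_m ∂_n`. -/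
def D (g : ℕ) : Module.End ℚ V :=
  -((g : ℚ) • partialOne) + (1 / 2 : ℚ) • diffOp fun n : Fin 2 → ℕ+ =>
    (((n 0 : ℕ) + (n 1 : ℕ)).choose (n 0 : ℕ) : ℚ) • x ((n 0 : ℕ) + (n 1 : ℕ) - 1)

/-- The grading `deg x_i = i`. -/
def deg : ℕ+ → ℕ := fun i => i

/-- The subspace `I_g`: the span of all polynomials that are homogeneous of degree `> g`
(for `deg x_i = i`), together with all `D^d (x₁^{m₁} … x_k^{m_k})` with `d ≥ 0`,
`m₁ + 2 m₂ + … + k m_k = g` and `m₁ < g`. -/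
def relations (g : ℕ) : Submodule ℚ V :=
  Submodule.span ℚ
    ({F : V | ∃ n : ℕ, g < n ∧ MvPolynomial.IsWeightedHomogeneous deg F n} ∪
     {F : V | ∃ (d : ℕ) (m : ℕ+ →₀ ℕ), Finsupp.weight deg m = g ∧ m 1 < g ∧
        F = (D g ^ d) (MvPolynomial.monomial m 1)})

/-- The right-hand side of the formula for the Fourier transform of
`x₁^[n] x_{n₁} … x_{n_k}`, up to the sign `(-1)^n`:
`∑ b(I₁) … b(I_m) x₁^[g - n - m - ∑ n_i] x_{d(I₁)} … x_{d(I_m)}`, over all partitions of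
`{1, …, k}` into nonempty subsets `I₁, …, I_m` with `m ≤ g - n - ∑ n_i`, where
`b(I) = (∑_{i ∈ I} n_i)! / ∏_{i ∈ I} n_i!`, `d(I) = ∑_{i ∈ I} n_i - |I| + 1` and
`x₁^[a] = x₁^a / a!`. -/
def fourierSum (g n : ℕ) {k : ℕ} (ν : Fin k → ℕ+) : V :=
  ∑ P : Finpartition (Finset.univ : Finset (Fin k)),
    if n + P.parts.card + ∑ i, (ν i : ℕ) ≤ g then
      ((1 / ((g - n - P.parts.card - ∑ i, (ν i : ℕ)) ! : ℚ)) •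
          x 1 ^ (g - n - P.parts.card - ∑ i, (ν i : ℕ))) *
        ∏ I ∈ P.parts,
          ((((∑ i ∈ I, (ν i : ℕ)) ! : ℚ) / ∏ i ∈ I, ((ν i : ℕ) ! : ℚ)) •
            x ((∑ i ∈ I, (ν i : ℕ)) + 1 - I.card))
    else 0

/-- The indices `n_i > 1` of the variables that occur in a monomial, listed in increasing order
with multiplicity: `x^m = x₁^(m 1) x_{n₁} … x_{n_k}`. -/
def higherIndices (m : ℕ+ →₀ ℕ) : List ℕ+ :=
  ((Finsupp.toMultiset m).filter fun i => 1 < i).sort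

/-- The linear operator `S` on `ℚ[x₁, x₂, …]` given on monomials by
`(-1)^n S(x₁^[n] x_{n₁} … x_{n_k}) = fourierSum g n (n₁, …, n_k)`, for `n_i > 1`. -/
def fourier (g : ℕ) : Module.End ℚ V :=
  (MvPolynomial.basisMonomials ℕ+ ℚ).constr ℚ fun m =>
    ((-1 : ℚ) ^ (m 1) * ((m 1) ! : ℚ)) • fourierSum g (m 1) (higherIndices m).get

end

end JacTaut

namespace JacTaut

open MvPolynomial

/-! ### The operators `gen a b` and their commutation with multiplication by variables -/

section Generators

/-! Everything is embedded in the family `gen a b`, which contains the variables (`gen 0 b` is `b!`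
times `x (b - 1)`) and the `Dk` (`gen k 0` is `k!` times `Dk k`). It satisfies the Poisson relations
`[gen a b, gen c d] = (a * d - b * c) • gen (a + c - 1) (b + d - 1)` (`gen_comm`). For `a + b ≥ 3`
the operator `gen a b` commutes with `∂₁`, so `[D, gen a b] = b • gen (a + 1) (b - 1)` (`D_gen`); in
particular `D` commutes with `Dk k` for `k ≥ 3`. Moreover `D`, `x₁` and `weightOp` form an
`sl₂`-triple up to normalization.

The ideal. An `sl₂` argument shows that in degree `g` every polynomial without a pure power of `x₁`
is `D` of something of degree `g + 1` (`IsBihom.exists_D_eq`). Hence `relations g` is spanned by the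
`D ^ d` of polynomials of degree `> g`, and the commutators with `D` show that it is stable under
`x₁` and under all `gen a b` with `a + b ≥ 3`, hence under all variables.

The Fourier transform. Let `dual g 1 = D` and `dual g k = Dk (k + 1)` for `k > 1`; these operators
commute. The partition formula for `S` says that `S` sends a product of variables to the
corresponding product of dual operators applied to `x₁^[g]`, so `S (x_k F) = dual_k (S F)` already
on `V` (`fourier_X_mul`). This is where the combinatorics enters: adjoining one index to a partition
sum (`gen_partitionSum`) amounts to an Abel-Hurwitz identity (`abel_sum`). Part (c) is then this
intertwining relation read in the quotient.

Descent and invertibility. Modulo relations, `S D = x₁ S` (`fourier_D_sub_mem`). Since `S` kills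
degree `> g`, it preserves the relations. Commutators propagate this to `S (gen a b) = (-1)^a (gen b
a) S`, so `S²` commutes with `x_k` up to the sign `(-1)^(k+1)`, and `S⁴ = 1`. -/

theorem partials_cons (a : ℕ+) (l : List ℕ+) (F : V) :
    partials (a :: l) F = pderiv a (partials l F) := by
  simp [partials]

theorem partials_X_mul (m : ℕ+) (F : V) (l : List ℕ+) :
    partials l (X m * F) = X m * partials l F +
      ∑ j : Fin l.length, if l.get j = m then partials (l.eraseIdx j) F else 0 := by
  induction l with
  | nil => simp [partials]
  | cons a l ih =>
    rw [partials_cons, ih, map_add, Derivation.leibniz, map_sum, partials_cons]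
    have h0 : ∑ j : Fin (a :: l).length,
        (if (a :: l).get j = m then partials ((a :: l).eraseIdx j) F else 0)
        = (if a = m then partials l F else 0) +
          ∑ j : Fin l.length, if l.get j = m then pderiv a (partials (l.eraseIdx j) F) else 0 := by
      refine (Fin.sum_univ_succ _).trans ?_
      simp only [List.get_eq_getElem, Fin.val_succ, List.getElem_cons_succ, List.eraseIdx_cons_succ,
        partials_cons, Fin.val_zero, List.getElem_cons_zero, List.eraseIdx_cons_zero]
      rfl
    rw [h0]
    have h1 : ∀ j : Fin l.length,
        pderiv a (if l.get j = m then partials (l.eraseIdx j) F else 0)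
        = if l.get j = m then pderiv a (partials (l.eraseIdx j) F) else 0 := by
      intro j; split_ifs <;> simp
    simp only [h1, smul_eq_mul]
    by_cases h : a = m
    · subst h; simp; ring
    · simp [h, pderiv_X_of_ne (fun e => h e.symm)]

theorem eraseIdx_ofFn {α : Type*} {k : ℕ} (n : Fin (k + 1) → α) (j : Fin (k + 1)) :
    (List.ofFn n).eraseIdx j = List.ofFn (j.removeNth n) := by
  apply List.ext_getElem
  · have := j.2
    simp only [List.length_eraseIdx, List.length_ofFn, this, if_true]
    omega
  · intro i h1 h2
    simp only [List.length_ofFn] at h2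
    rw [List.getElem_eraseIdx]
    simp only [List.getElem_ofFn, Fin.removeNth_apply, Fin.succAbove]
    by_cases h : i < (j : ℕ)
    · simp [h, Fin.lt_def]
    · simp [h, Fin.lt_def]

theorem partials_ofFn_X_mul {k : ℕ} (m : ℕ+) (F : V) (n : Fin (k + 1) → ℕ+) :
    partials (List.ofFn n) (X m * F) = X m * partials (List.ofFn n) F +
      ∑ j, if n j = m then partials (List.ofFn (j.removeNth n)) F else 0 := by
  rw [partials_X_mul]
  congr 1
  refine Fintype.sum_equiv (finCongr (List.length_ofFn)) _ _ fun j => ?_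
  have := eraseIdx_ofFn n (finCongr (List.length_ofFn) j)
  simp only [finCongr_apply, Fin.val_cast] at this
  simp only [this, List.get_ofFn, finCongr_apply]

theorem diffOp_apply {k : ℕ} (c : (Fin k → ℕ+) → V) (F : V) :
    diffOp c F = ∑ᶠ n : Fin k → ℕ+, c n * partials (List.ofFn n) F := rfl

theorem finsum_fiber_insertNth {k : ℕ} (j : Fin (k + 1)) (m : ℕ+) (f : (Fin (k + 1) → ℕ+) → V)
    (h : ∀ n, n j ≠ m → f n = 0) :
    ∑ᶠ n, f n = ∑ᶠ n' : Fin k → ℕ+, f (j.insertNth m n') := by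
  have hinj : Function.Injective fun n' : Fin k → ℕ+ =>
      (j.insertNth m n' : Fin (k + 1) → ℕ+) :=
    Fin.insertNth_right_injective (α := fun _ => ℕ+) (p := j) m
  rw [← finsum_mem_range (f := f) hinj, ← finsum_mem_univ f]
  refine finsum_mem_inter_support_eq' _ _ _ fun n hn => ?_
  simp only [Set.mem_univ, Set.mem_range, true_iff]
  have : n j = m := by
    by_contra hne
    exact hn (h n hne)
  exact ⟨j.removeNth n, by rw [← this]; exact Fin.insertNth_self_removeNth j n⟩

/-- Leibniz rule: the derivative in slot `j` hits `X m` exactly when its index is `m`, which freezes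
that slot and lowers the order by one. -/
theorem diffOp_X_mul {k : ℕ} (c : (Fin (k + 1) → ℕ+) → V) (m : ℕ+) (F : V) :
    diffOp c (X m * F) = X m * diffOp c F +
      ∑ j, diffOp (fun n' : Fin k → ℕ+ => c ((j : Fin (k + 1)).insertNth m n')) F := by
  have hsupp : ∀ j : Fin (k + 1), (Function.support fun n : Fin (k + 1) → ℕ+ =>
      c n * if n j = m then partials (List.ofFn (j.removeNth n)) F else 0).Finite := by
    intro j
    refine ((finite_support_diffOp (fun n' => c (j.insertNth m n')) F).image
      fun n' : Fin k → ℕ+ => (j.insertNth m n' : Fin (k + 1) → ℕ+)).subset ?_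
    intro n hn
    have hn' := hn
    rw [Function.mem_support] at hn
    have hj : n j = m := by
      by_contra hne
      simp [hne] at hn
    have he : (j.insertNth m (j.removeNth n) : Fin (k + 1) → ℕ+) = n := by
      rw [← hj]; exact Fin.insertNth_self_removeNth j n
    refine ⟨j.removeNth n, ?_, he⟩
    rw [if_pos hj] at hn
    simpa only [Function.mem_support, he] using hn
  simp only [diffOp_apply, partials_ofFn_X_mul, mul_add, Finset.mul_sum]
  rw [finsum_add_distrib, finsum_sum_comm]
  · congr 1
    · rw [← smul_eq_mul, smul_finsum' _ (finite_support_diffOp c F)]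
      refine finsum_congr fun n => ?_
      rw [smul_eq_mul]; ring
    · refine Finset.sum_congr rfl fun j _ => ?_
      rw [finsum_fiber_insertNth j m]
      · refine finsum_congr fun n' => ?_
        simp
      · intro n hn
        simp [hn]
  · exact fun j _ => hsupp j
  · refine (finite_support_diffOp c F).subset fun n hn => ?_
    rw [Function.mem_support] at hn ⊢
    intro h0
    exact hn (by rw [mul_left_comm, h0, mul_zero])
  · refine (Set.finite_iUnion hsupp).subset fun n hn => ?_
    obtain ⟨j, -, hj⟩ := Finset.exists_ne_zero_of_sum_ne_zero hn
    exact Set.mem_iUnion.2 ⟨j, hj⟩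

/-- The operator `∑_{n₁, …, n_a} (n₁ + … + n_a + b)! / (n₁! … n_a!)
  x_{n₁ + … + n_a + b - 1} ∂_{n₁} … ∂_{n_a}`. These operators quantize the polynomial
Hamiltonians `t ^ b * ξ ^ a` of the plane. -/
noncomputable def gen (a b : ℕ) : Module.End ℚ V :=
  diffOp fun n : Fin a → ℕ+ =>
    (((∑ i, (n i : ℕ) + b) ! : ℚ) / ∏ i, ((n i : ℕ) ! : ℚ)) • x (∑ i, (n i : ℕ) + b - 1)

theorem diffOp_smul {k : ℕ} (r : ℚ) (c : (Fin k → ℕ+) → V) :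
    diffOp (fun n => r • c n) = r • diffOp c := by
  refine LinearMap.ext fun G => ?_
  rw [LinearMap.smul_apply, diffOp_apply, diffOp_apply,
    smul_finsum' _ (finite_support_diffOp c _)]
  simp only [smul_mul_assoc]

theorem Dk_eq (k : ℕ) : Dk k = (1 / (k ! : ℚ)) • gen k 0 := by
  simp [Dk, gen]

theorem gen_zero (b : ℕ) (F : V) : gen 0 b F = ((b ! : ℚ) • x (b - 1)) * F := by
  simp only [gen, diffOp_apply]
  rw [finsum_eq_single _ (fun i => i.elim0)]
  · simp [partials]
  · intro n hn; exact (hn (Subsingleton.elim _ _)).elim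

theorem gen_succ_one (a b : ℕ) : gen (a + 1) b 1 = 0 := by
  simp only [gen, diffOp_apply]
  refine finsum_eq_zero_of_forall_eq_zero fun n => ?_
  have : partials (List.ofFn n) (1 : V) = 0 := by
    by_contra h
    have := mem_vars_of_partials_ne_zero h (n 0) (by simp [List.mem_ofFn])
    simp at this
  rw [this, mul_zero]

/-- The coefficients are symmetric, so the `a` slots contribute equally. Together with the value at
`1`, this recursion determines `gen a b`, and operator identities below are checked by induction
along it. For `a = 0` the coefficient vanishes, so the truncated `a - 1` is harmless. -/
theorem gen_X_mul (a b : ℕ) (m : ℕ+) (F : V) :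
    gen a b (X m * F) = X m * gen a b F +
      ((a : ℚ) / ((m : ℕ) ! : ℚ)) • gen (a - 1) (b + m) F := by
  cases a with
  | zero => simp only [gen_zero, Nat.cast_zero, zero_div, zero_smul, add_zero]; ring
  | succ a =>
    rw [gen, diffOp_X_mul]
    congr 1
    have : ∀ j : Fin (a + 1), diffOp (fun n' : Fin a → ℕ+ =>
        (fun n : Fin (a + 1) → ℕ+ =>
          (((∑ i, (n i : ℕ) + b) ! : ℚ) / ∏ i, ((n i : ℕ) ! : ℚ)) • x (∑ i, (n i : ℕ) + b - 1))
        (j.insertNth m n')) = (1 / ((m : ℕ) ! : ℚ)) • gen a (b + m) := by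
      intro j
      rw [gen, ← diffOp_smul]
      congr 1
      funext n'
      simp only [Fin.sum_univ_succAbove _ j, Fin.prod_univ_succAbove _ j, Fin.insertNth_apply_same,
        Fin.insertNth_apply_succAbove, smul_smul]
      have e : (m : ℕ) + ∑ i, (n' i : ℕ) + b = ∑ i, (n' i : ℕ) + (b + m) := by ring
      rw [e]
      congr 1
      field_simp
    simp only [this, Finset.sum_const, Finset.card_univ, Fintype.card_fin, LinearMap.smul_apply,
      ← Nat.cast_smul_eq_nsmul ℚ, smul_smul]
    simp [div_eq_mul_inv]

/-- Induction on polynomials by multiplication with variables. -/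
theorem induction_X_mul {P : V → Prop} (hadd : ∀ F G, P F → P G → P (F + G))
    (hsmul : ∀ (r : ℚ) F, P F → P (r • F)) (one : P 1) (X_mul : ∀ m F, P F → P (X m * F)) (F : V) :
    P F := by
  induction F using MvPolynomial.induction_on with
  | C a =>
    have := hsmul a 1 one
    rwa [smul_eq_C_mul, mul_one] at this
  | add p q hp hq => exact hadd p q hp hq
  | mul_X p n hp => rw [mul_comm]; exact X_mul n p hp

theorem x_coe (m : ℕ+) : x (m : ℕ) = X m := by simp [x]

theorem gen_x_mul (a b : ℕ) {m : ℕ} (hm : 0 < m) (F : V) :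
    gen a b (x m * F) = x m * gen a b F + ((a : ℚ) / (m ! : ℚ)) • gen (a - 1) (b + m) F := by
  lift m to ℕ+ using hm
  rw [x_coe, gen_X_mul]

theorem gen_zero_x (a b d : ℕ) (F : V) :
    gen a b (gen 0 (d + 2) F) = gen 0 (d + 2) (gen a b F) +
      ((a : ℚ) * (d + 2)) • gen (a - 1) (b + d + 1) F := by
  rw [gen_zero, smul_mul_assoc, map_smul, gen_x_mul _ _ (by omega), gen_zero, smul_add, smul_smul,
    smul_mul_assoc]
  congr 2
  have h1 : ((d + 1)! : ℚ) ≠ 0 := by positivity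
  rw [show d + 2 - 1 = d + 1 from rfl, show (d + 2)! = (d + 2) * (d + 1)! from rfl]
  push_cast
  field_simp

end Generators

/-! ### Poisson relations and the triple `D`, `x₁`, `weightOp` -/

section Commutators

theorem gen_zero_comm {b : ℕ} (hb : 2 ≤ b) (c d : ℕ) (F : V) :
    gen 0 b (gen (c + 1) d F) = gen (c + 1) d (gen 0 b F) +
      (((0 : ℕ) : ℚ) * d - b * (c + 1 : ℕ)) • gen c (b + d - 1) F := by
  obtain ⟨b, rfl⟩ := Nat.exists_eq_add_of_le' hb
  rw [gen_zero_x, Nat.add_sub_cancel, show b + 2 + d - 1 = d + b + 1 by omega]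
  push_cast
  module

/-- Both sides kill `1` and obey the same recursion under multiplication by `X m`. The indices stay
quantified because passing `X m` shifts them. The bounds guarantee that every `gen 0 b` met on the
way has `b ≥ 2`, hence is a multiple of a genuine variable. -/
theorem gen_succ_comm (F : V) : ∀ a b c d : ℕ, 1 ≤ a + b → 1 ≤ c + d →
    gen (a + 1) b (gen (c + 1) d F) = gen (c + 1) d (gen (a + 1) b F) +
      (((a + 1 : ℕ) : ℚ) * d - b * (c + 1 : ℕ)) • gen (a + c + 1) (b + d - 1) F := by
  induction F using induction_X_mul with
  | hadd F G hF hG =>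
    intro a b c d hab hcd
    simp only [map_add, hF a b c d hab hcd, hG a b c d hab hcd, smul_add]
    abel
  | hsmul r F hF =>
    intro a b c d hab hcd
    simp only [map_smul, hF a b c d hab hcd, smul_add]
    rw [smul_comm]
  | one => intro a b c d _ _; simp [gen_succ_one]
  | X_mul m F ih =>
    intro a b c d hab hcd
    have hm := m.pos
    have key : ∀ a b c d : ℕ, 1 ≤ a + b → 1 ≤ c + d →
        gen a (b + m) (gen (c + 1) d F) =
        gen (c + 1) d (gen a (b + m) F) +
          ((a : ℚ) * d - (b + m : ℕ) * (c + 1 : ℕ)) • gen (a + c) (b + m + d - 1) F := by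
      intro a b c d hab hcd
      cases a with
      | zero => rw [gen_zero_comm (by omega), zero_add]
      | succ a => rw [ih a (b + m) c d (by omega) hcd, show a + 1 + c = a + c + 1 by ring]
    have key2 : gen (a + 1) b (gen c (d + m) F) = gen c (d + m) (gen (a + 1) b F) -
          ((c : ℚ) * b - (d + m : ℕ) * (a + 1 : ℕ)) • gen (a + c) (b + m + d - 1) F := by
      rw [key c d a b hcd hab, show d + m + b - 1 = b + m + d - 1 by omega, add_comm c a]
      abel
    simp only [gen_X_mul, map_add, map_smul, Nat.add_sub_cancel, ih a b c d hab hcd,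
      key a b c d hab hcd, key2, smul_add, mul_add, mul_smul_comm, smul_sub]
    -- For `b = d = 0` the index `b + d - 1` is truncated, but its coefficient is zero.
    rcases Nat.eq_zero_or_pos (b + d) with h | h
    · obtain ⟨rfl, rfl⟩ : b = 0 ∧ d = 0 := by omega
      push_cast
      module
    · rw [show b + d - 1 + m = b + m + d - 1 by omega]
      push_cast
      module

theorem gen_comm {a b c d : ℕ} (hab : 2 ≤ a + b) (hcd : 2 ≤ c + d) (F : V) :
    gen a b (gen c d F) = gen c d (gen a b F) +
      ((a : ℚ) * d - b * c) • gen (a + c - 1) (b + d - 1) F := by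
  rcases a with _ | a <;> rcases c with _ | c
  · simp only [gen_zero]
    rw [mul_left_comm]
    simp
  · rw [gen_zero_comm (by omega)]
    simp
  · have := gen_zero_comm (b := d) (by omega) a b F
    rw [this, add_comm d b]
    simp only [add_zero, Nat.add_sub_cancel]
    push_cast
    module
  · rw [gen_succ_comm F a b c d (by omega) (by omega)]
    rw [show a + 1 + (c + 1) - 1 = a + c + 1 by omega]

theorem partialOne_X_mul (m : ℕ+) (F : V) :
    partialOne (X m * F) = X m * partialOne F + if m = 1 then F else 0 := by
  simp only [partialOne, Derivation.coeFn_coe, Derivation.leibniz, smul_eq_mul]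
  by_cases h : m = 1
  · subst h; simp
  · simp [h, pderiv_X_of_ne h]

theorem partialOne_one : partialOne 1 = 0 := by simp [partialOne]

/-- The sum `a + b` never decreases along `gen_X_mul`, so the recursion ends in variables `x (b -
1)` with `b - 1 ≥ 2`, which `∂₁` annihilates. -/
theorem partialOne_gen (F : V) : ∀ a b : ℕ, 3 ≤ a + b →
    partialOne (gen a b F) = gen a b (partialOne F) := by
  induction F using induction_X_mul with
  | hadd F G hF hG => intro a b h; simp only [map_add, hF a b h, hG a b h]
  | hsmul r F hF => intro a b h; simp only [map_smul, hF a b h]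
  | one =>
    intro a b h
    rcases a with _ | a
    · simp only [gen_zero, partialOne_one, mul_zero, mul_one, map_smul]
      have := partialOne_X_mul (b - 1).toPNat' 1
      rw [mul_one, partialOne_one, if_neg] at this
      · rw [x, this]; simp
      · intro e
        have := congrArg PNat.val e
        rw [PNat.toPNat'_coe] at this <;> simp at this <;> omega
    · simp [gen_succ_one, partialOne_one]
  | X_mul m F ih =>
    intro a b h
    have hm := m.pos
    simp only [gen_X_mul, partialOne_X_mul, map_add, map_smul, ih a b h]
    have h2 : (a : ℚ) • partialOne (gen (a - 1) (b + m) F) =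
        (a : ℚ) • gen (a - 1) (b + m) (partialOne F) := by
      rcases a with _ | a
      · simp
      · rw [ih _ _ (by omega)]
    rw [div_eq_inv_mul, mul_smul, mul_smul, h2]
    split_ifs
    · abel
    · simp

theorem gen_one_one_X_mul (m : ℕ+) (F : V) :
    gen 1 1 (X m * F) = X m * gen 1 1 F + ((m : ℚ) + 1) • (X m * F) := by
  rw [gen_X_mul, gen_zero, Nat.add_sub_cancel_left, x_coe, smul_mul_assoc, smul_smul,
    Nat.add_comm 1 (m : ℕ), Nat.factorial_succ]
  have : ((m : ℕ) ! : ℚ) ≠ 0 := by positivity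
  congr 2
  push_cast
  field_simp

theorem partialOne_gen_one_one (F : V) :
    partialOne (gen 1 1 F) = gen 1 1 (partialOne F) + (2 : ℚ) • partialOne F := by
  induction F using induction_X_mul with
  | hadd F G hF hG => simp only [map_add, hF, hG, smul_add]; abel
  | hsmul r F hF => simp only [map_smul, hF, smul_add, smul_comm r]
  | one => simp [gen_succ_one, partialOne_one]
  | X_mul m F ih =>
    simp only [gen_one_one_X_mul, partialOne_X_mul, map_add, map_smul, ih, smul_add, mul_add]
    split_ifs with h
    · subst h
      norm_num
    · simp only [map_zero, mul_smul_comm]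
      module

theorem D_eq (g : ℕ) : D g = Dk 2 - (g : ℚ) • partialOne := by
  rw [D, Dk_eq, sub_eq_neg_add]
  congr 1
  rw [gen, ← diffOp_smul, ← diffOp_smul]
  congr 1
  funext n
  simp only [Fin.sum_univ_two, Fin.prod_univ_two, add_zero, Nat.factorial_two]
  rw [Nat.cast_choose ℚ (Nat.le_add_right _ _), Nat.add_sub_cancel_left]
  simp

theorem D_apply (g : ℕ) (F : V) :
    D g F = (1 / 2 : ℚ) • gen 2 0 F - (g : ℚ) • partialOne F := by
  simp [D_eq, Dk_eq]

theorem D_gen (g : ℕ) {a b : ℕ} (h : 3 ≤ a + b) (F : V) :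
    D g (gen a b F) = gen a b (D g F) + (b : ℚ) • gen (a + 1) (b - 1) F := by
  simp only [D_apply, partialOne_gen F a b h, map_sub, map_smul]
  rw [gen_comm (by omega) (by omega), show 2 + a - 1 = a + 1 by omega, zero_add]
  push_cast
  module

/-- The weight operator `[D, x₁]`. -/
noncomputable def weightOp (g : ℕ) : Module.End ℚ V := gen 1 1 - (g : ℚ) • 1

theorem weightOp_apply (g : ℕ) (F : V) : weightOp g F = gen 1 1 F - (g : ℚ) • F := by
  simp [weightOp]

theorem D_X_mul (g : ℕ) (m : ℕ+) (F : V) :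
    D g (X m * F) = X m * D g F + (1 / ((m : ℕ) ! : ℚ)) • gen 1 m F -
      if m = 1 then (g : ℚ) • F else 0 := by
  simp only [D_apply, gen_X_mul, partialOne_X_mul, mul_sub, smul_add, mul_smul_comm, zero_add]
  split_ifs <;> norm_num <;> module

theorem D_X_one_mul (g : ℕ) (F : V) : D g (X 1 * F) = X 1 * D g F + weightOp g F := by
  rw [D_X_mul, weightOp_apply]
  simp
  abel

theorem weightOp_D (g : ℕ) (F : V) :
    weightOp g (D g F) = D g (weightOp g F) - (2 : ℚ) • D g F := by
  have h1 := gen_comm (a := 1) (b := 1) (c := 2) (d := 0) (by norm_num) (by norm_num) F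
  simp only [weightOp_apply, map_sub, map_smul]
  simp only [D_apply, map_sub, map_smul, h1, partialOne_gen_one_one]
  norm_num
  module

theorem D_one (g : ℕ) : D g 1 = 0 := by simp [D_apply, gen_succ_one, partialOne_one]

theorem weightOp_one (g : ℕ) : weightOp g 1 = -((g : ℚ) • 1) := by
  simp [weightOp_apply, gen_succ_one]

theorem weightOp_X_mul (g : ℕ) (m : ℕ+) (F : V) :
    weightOp g (X m * F) = X m * weightOp g F + ((m : ℚ) + 1) • (X m * F) := by
  simp only [weightOp_apply, gen_one_one_X_mul, mul_sub, mul_smul_comm]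
  module

end Commutators

/-! ### The bigrading by weight and number of factors, and the ideal of the `x_n` with `n ≠ 1` -/

section Grading

/-- The monomial with exponents `m` and coefficient `1`. -/
noncomputable def mono (m : ℕ+ →₀ ℕ) : V := monomial m 1

theorem mono_zero : mono 0 = 1 := rfl

theorem mono_single_add (n : ℕ+) (m : ℕ+ →₀ ℕ) :
    mono (Finsupp.single n 1 + m) = X n * mono m := by
  simp [mono, X, monomial_mul]

theorem monomial_induction {P : (ℕ+ →₀ ℕ) → Prop} (zero : P 0)
    (single_add : ∀ n m, P m → P (Finsupp.single n 1 + m)) (m : ℕ+ →₀ ℕ) : P m := by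
  induction m using Finsupp.induction with
  | zero => exact zero
  | single_add a b f _ _ ih =>
    clear * - ih single_add
    induction b with
    | zero => simpa using ih
    | succ b hb =>
      rw [add_comm b 1, Finsupp.single_add, add_assoc]
      exact single_add _ _ hb

theorem mem_span_mono {s : Set (ℕ+ →₀ ℕ)} {F : V} (h : ∀ m, coeff m F ≠ 0 → m ∈ s) :
    F ∈ Submodule.span ℚ (mono '' s) := by
  rw [F.as_sum]
  refine Submodule.sum_mem _ fun m hm => ?_
  have : monomial m (coeff m F) = coeff m F • mono m := by simp [mono, smul_monomial]
  rw [this]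
  exact Submodule.smul_mem _ _ (Submodule.subset_span ⟨m, h m (mem_support_iff.1 hm), rfl⟩)

/-- The bidegree of the variables: their weight, and their number. -/
def bideg : ℕ+ → ℤ × ℤ := fun n => ((n : ℕ), 1)

/-- The polynomial `F` is homogeneous of degree `p`, with `r` factors in every monomial. -/
def IsBihom (F : V) (p r : ℤ) : Prop := IsWeightedHomogeneous bideg F (p, r)

theorem weight_bideg (m : ℕ+ →₀ ℕ) :
    Finsupp.weight bideg m = (((Finsupp.weight deg m : ℕ) : ℤ), ((m.degree : ℕ) : ℤ)) := by
  induction m using monomial_induction with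
  | zero => simp; rfl
  | single_add n m ih =>
    simp only [map_add, ih, Finsupp.weight_single, Finsupp.degree_single]
    simp [bideg, deg]

theorem isBihom_mono (m : ℕ+ →₀ ℕ) : IsBihom (mono m) (Finsupp.weight deg m : ℕ) (m.degree : ℕ) :=
  isWeightedHomogeneous_monomial _ _ _ (weight_bideg m)

theorem IsBihom.of_coeff {F : V} {p r : ℤ} (h : IsBihom F p r) {m : ℕ+ →₀ ℕ}
    (hm : coeff m F ≠ 0) : ((Finsupp.weight deg m : ℕ) : ℤ) = p ∧ ((m.degree : ℕ) : ℤ) = r := by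
  have := h hm
  rw [weight_bideg] at this
  exact Prod.ext_iff.1 this

theorem IsBihom.mem_span {F : V} {p r : ℤ} (h : IsBihom F p r) : F ∈ Submodule.span ℚ
    (mono '' {m | ((Finsupp.weight deg m : ℕ) : ℤ) = p ∧ ((m.degree : ℕ) : ℤ) = r}) :=
  mem_span_mono fun _ hm => h.of_coeff hm

theorem IsBihom.smul {F : V} {p r : ℤ} (h : IsBihom F p r) (c : ℚ) : IsBihom (c • F) p r :=
  Submodule.smul_mem (weightedHomogeneousSubmodule ℚ bideg (p, r)) c h

theorem IsBihom.add {F G : V} {p r : ℤ} (h : IsBihom F p r) (h' : IsBihom G p r) :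
    IsBihom (F + G) p r := IsWeightedHomogeneous.add h h'

theorem IsBihom.sub {F G : V} {p r : ℤ} (h : IsBihom F p r) (h' : IsBihom G p r) :
    IsBihom (F - G) p r := IsWeightedHomogeneous.sub h h'

theorem isBihom_zero (p r : ℤ) : IsBihom 0 p r := isWeightedHomogeneous_zero _ _ _

theorem IsBihom.X_mul {F : V} {p r : ℤ} (h : IsBihom F p r) (n : ℕ+) :
    IsBihom (X n * F) (p + (n : ℕ)) (r + 1) := by
  have := (isWeightedHomogeneous_X ℚ bideg n).mul h
  rwa [add_comm] at this

theorem IsBihom.of_mono {A : Module.End ℚ V} {δ ε : ℤ}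
    (hA : ∀ m : ℕ+ →₀ ℕ,
      IsBihom (A (mono m)) ((Finsupp.weight deg m : ℕ) + δ) ((m.degree : ℕ) + ε))
    {F : V} {p r : ℤ} (h : IsBihom F p r) : IsBihom (A F) (p + δ) (r + ε) := by
  have hF := h.mem_span
  clear h
  induction hF using Submodule.span_induction with
  | mem F hF =>
    obtain ⟨m, ⟨h1, h2⟩, rfl⟩ := hF
    rw [← h1, ← h2]
    exact hA m
  | zero => simpa using isBihom_zero _ _
  | add F G _ _ hF hG => rw [map_add]; exact hF.add hG
  | smul c F _ hF => rw [map_smul]; exact hF.smul c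

theorem isBihom_one : IsBihom 1 0 0 := isWeightedHomogeneous_one _ _

theorem isBihom_x {n : ℕ} (hn : 0 < n) : IsBihom (x n) n 1 := by
  lift n to ℕ+ using hn
  rw [x_coe]
  exact isWeightedHomogeneous_X _ _ _

theorem isBihom_gen_mono (m : ℕ+ →₀ ℕ) : ∀ a b : ℕ, 2 ≤ a + b →
    IsBihom (gen a b (mono m)) ((Finsupp.weight deg m : ℕ) + ((b : ℤ) - 1))
      ((m.degree : ℕ) + (1 - (a : ℤ))) := by
  induction m using monomial_induction with
  | zero =>
    intro a b h
    rw [mono_zero]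
    rcases a with _ | a
    · rw [gen_zero, mul_one]
      have := (isBihom_x (n := b - 1) (by omega)).smul (b ! : ℚ)
      convert this using 1
      · simp; omega
      · simp
    · rw [gen_succ_one]; exact isBihom_zero _ _
  | single_add n m ih =>
    intro a b h
    have hn := n.pos
    rw [mono_single_add, gen_X_mul]
    have e : ((Finsupp.weight deg (Finsupp.single n 1 + m) : ℕ) : ℤ) =
        (Finsupp.weight deg m : ℕ) + (n : ℕ) := by
      simp [Finsupp.weight_single, deg]; ring
    have e' : (((Finsupp.single n 1 + m).degree : ℕ) : ℤ) = (m.degree : ℕ) + 1 := by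
      simp; ring
    rw [e, e']
    refine IsBihom.add ?_ ?_
    · convert (ih a b h).X_mul n using 1 <;> ring
    · rcases a with _ | a
      · simpa using isBihom_zero _ _
      · refine IsBihom.smul ?_ _
        convert ih a (b + n) (by omega) using 1 <;> push_cast <;> ring

theorem IsBihom.gen {F : V} {p r : ℤ} (h : IsBihom F p r) {a b : ℕ} (hab : 2 ≤ a + b) :
    IsBihom (gen a b F) (p + ((b : ℤ) - 1)) (r + (1 - (a : ℤ))) :=
  IsBihom.of_mono (fun m => isBihom_gen_mono m a b hab) h

theorem isBihom_partialOne_mono (m : ℕ+ →₀ ℕ) :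
    IsBihom (partialOne (mono m)) ((Finsupp.weight deg m : ℕ) + (-1)) ((m.degree : ℕ) + (-1)) := by
  induction m using monomial_induction with
  | zero => rw [mono_zero, partialOne_one]; exact isBihom_zero _ _
  | single_add n m ih =>
    rw [mono_single_add, partialOne_X_mul]
    have e : ((Finsupp.weight deg (Finsupp.single n 1 + m) : ℕ) : ℤ) =
        (Finsupp.weight deg m : ℕ) + (n : ℕ) := by
      simp [Finsupp.weight_single, deg]; ring
    have e' : (((Finsupp.single n 1 + m).degree : ℕ) : ℤ) = (m.degree : ℕ) + 1 := by
      simp; ring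
    rw [e, e']
    refine IsBihom.add ?_ ?_
    · convert ih.X_mul n using 1 <;> ring
    · split_ifs with h
      · subst h
        convert isBihom_mono m using 1 <;> simp
      · exact isBihom_zero _ _

theorem IsBihom.D {F : V} {p r : ℤ} (h : IsBihom F p r) (g : ℕ) :
    IsBihom (D g F) (p - 1) (r - 1) := by
  rw [D_apply]
  refine IsBihom.sub ?_ ?_
  · refine IsBihom.smul ?_ _
    convert h.gen (a := 2) (b := 0) (by norm_num) using 1 <;> norm_num <;> ring
  · exact (h.of_mono isBihom_partialOne_mono).smul _

theorem IsBihom.D_pow {F : V} {p r : ℤ} (h : IsBihom F p r) (g d : ℕ) :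
    IsBihom ((JacTaut.D g ^ d) F) (p - d) (r - d) := by
  induction d with
  | zero => simpa using h
  | succ d ih =>
    rw [pow_succ', Module.End.mul_apply]
    convert ih.D g using 1 <;> push_cast <;> ring

theorem IsBihom.eq_zero_of_neg {F : V} {p r : ℤ} (h : IsBihom F p r) (hp : p < 0 ∨ r < 0) :
    F = 0 := by
  by_contra h0
  obtain ⟨m, hm⟩ := MvPolynomial.ne_zero_iff.1 h0
  have := h.of_coeff hm
  omega

theorem weightOp_mono (g : ℕ) (m : ℕ+ →₀ ℕ) : weightOp g (mono m) =
    (((Finsupp.weight deg m : ℕ) : ℚ) + (m.degree : ℕ) - g) • mono m := by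
  induction m using monomial_induction with
  | zero => rw [mono_zero, weightOp_one]; simp
  | single_add n m ih =>
    rw [mono_single_add, weightOp_X_mul, ih, mul_smul_comm, ← add_smul]
    congr 1
    simp [Finsupp.weight_single, deg]
    ring

/-- This makes `weightOp` the Cartan element of the triple: it acts on each bidegree by a scalar. -/
theorem IsBihom.weightOp {F : V} {p r : ℤ} (h : IsBihom F p r) (g : ℕ) :
    weightOp g F = ((p : ℚ) + r - g) • F := by
  have hF := h.mem_span
  clear h
  induction hF using Submodule.span_induction with
  | mem F hF =>
    obtain ⟨m, ⟨h1, h2⟩, rfl⟩ := hF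
    rw [← h1, ← h2, weightOp_mono]
    simp
  | zero => simp
  | add F G _ _ hF hG => rw [map_add, hF, hG, smul_add]
  | smul c F _ hF => rw [map_smul, hF, smul_comm]

/-- Polynomials all of whose monomials involve some `x_n` with `n ≠ 1`. -/
noncomputable def higher : Ideal V := Ideal.span (X '' {n : ℕ+ | n ≠ 1})

theorem X_mem_higher {n : ℕ+} (hn : n ≠ 1) : (X n : V) ∈ higher := Ideal.subset_span ⟨n, hn, rfl⟩

theorem mem_higher_iff {F : V} : F ∈ higher ↔ ∀ m, coeff m F ≠ 0 → ∃ n, n ≠ 1 ∧ m n ≠ 0 := by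
  simp [higher, mem_ideal_span_X_image]

theorem smul_mem_higher (c : ℚ) {F : V} (h : F ∈ higher) : c • F ∈ higher := by
  rw [smul_eq_C_mul]; exact Ideal.mul_mem_left _ _ h

theorem gen_mem_higher (F : V) : ∀ a b : ℕ, 3 ≤ a + b → gen a b F ∈ higher := by
  induction F using induction_X_mul with
  | hadd F G hF hG => intro a b h; rw [map_add]; exact add_mem (hF a b h) (hG a b h)
  | hsmul r F hF => intro a b h; rw [map_smul]; exact smul_mem_higher _ (hF a b h)
  | one =>
    intro a b h
    rcases a with _ | a
    · rw [gen_zero, mul_one]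
      refine smul_mem_higher _ (X_mem_higher fun e => ?_)
      have := congrArg PNat.val e
      rw [PNat.toPNat'_coe] at this <;> simp at this <;> omega
    · rw [gen_succ_one]; exact zero_mem _
  | X_mul m F ih =>
    intro a b h
    have hm := m.pos
    rw [gen_X_mul]
    refine add_mem (Ideal.mul_mem_left _ _ (ih a b h)) ?_
    rcases a with _ | a
    · simp
    · exact smul_mem_higher _ (ih _ _ (by omega))

theorem D_X_mul_mem_higher (g : ℕ) {n : ℕ+} (hn : n ≠ 1) (F : V) : D g (X n * F) ∈ higher := by
  rw [D_X_mul, if_neg hn, sub_zero]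
  have h2 : 1 < n := lt_of_le_of_ne one_le hn.symm
  have h3 : 1 < (n : ℕ) := h2
  exact add_mem (Ideal.mul_mem_right _ _ (X_mem_higher hn))
    (smul_mem_higher _ (gen_mem_higher _ _ _ (by omega)))

theorem exists_mono_eq_X_mul {m : ℕ+ →₀ ℕ} {n : ℕ+} (h : m n ≠ 0) :
    ∃ m', mono m = X n * mono m' := by
  refine ⟨m - Finsupp.single n 1, ?_⟩
  rw [← mono_single_add, add_tsub_cancel_of_le]
  simpa using Nat.one_le_iff_ne_zero.2 h

theorem D_mem_higher (g : ℕ) {F : V} (hF : F ∈ higher) : D g F ∈ higher := by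
  have := mem_span_mono (mem_higher_iff.1 hF)
  clear hF
  induction this using Submodule.span_induction with
  | mem F hF =>
    obtain ⟨m, ⟨n, hn, hmn⟩, rfl⟩ := hF
    obtain ⟨m', h⟩ := exists_mono_eq_X_mul hmn
    rw [h]
    exact D_X_mul_mem_higher g hn _
  | zero => simp
  | add F G _ _ hF hG => rw [map_add]; exact add_mem hF hG
  | smul c F _ hF => rw [map_smul]; exact smul_mem_higher _ hF

theorem D_pow_mem_higher (g d : ℕ) {F : V} (hF : F ∈ higher) : (D g ^ d) F ∈ higher := by
  induction d with
  | zero => simpa using hF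
  | succ d ih => rw [pow_succ', Module.End.mul_apply]; exact D_mem_higher g ih

theorem IsBihom.eq_zero_of_mem_higher {F : V} {p : ℤ} (h : IsBihom F p 0) (h' : F ∈ higher) :
    F = 0 := by
  by_contra h0
  obtain ⟨m, hm⟩ := MvPolynomial.ne_zero_iff.1 h0
  obtain ⟨n, -, hn⟩ := mem_higher_iff.1 h' m hm
  have := (h.of_coeff hm).2
  simp only [Nat.cast_eq_zero, Finsupp.degree_eq_zero_iff] at this
  simp [this] at hn

end Grading

/-! ### The relations form an ideal stable under `D` and the `gen a b` with `a + b ≥ 3` -/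

section Relations

/-- Each passage of `D` through a factor `x₁` leaves the weight `p + r - g + 2 * i`, and the
constant is the sum of these over `i ≤ j`. -/
theorem D_X_one_pow_mul (g : ℕ) (j : ℕ) {F : V} {p r : ℤ} (h : IsBihom F p r) :
    D g (X 1 ^ (j + 1) * F) = X 1 ^ (j + 1) * D g F +
      (((j : ℚ) + 1) * (p + r - g + j)) • (X 1 ^ j * F) := by
  have hX : ∀ j : ℕ, IsBihom (X 1 ^ j * F) (p + j) (r + j) := by
    intro j
    induction j with
    | zero => simpa using h
    | succ j ih =>
      rw [pow_succ', mul_assoc]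
      convert ih.X_mul 1 using 1 <;> push_cast <;> ring
  induction j with
  | zero => simp [D_X_one_mul, h.weightOp]
  | succ j ih =>
    rw [pow_succ', mul_assoc, D_X_one_mul, ih, (hX (j + 1)).weightOp]
    simp only [mul_add, mul_smul_comm, ← mul_assoc, ← pow_succ']
    push_cast
    module

theorem mono_mem_relations {g : ℕ} {m : ℕ+ →₀ ℕ} (h : g < Finsupp.weight deg m) :
    mono m ∈ relations g :=
  Submodule.subset_span (Or.inl ⟨_, h, isWeightedHomogeneous_monomial _ _ _ rfl⟩)

theorem IsBihom.mem_relations {g : ℕ} {F : V} {p r : ℤ} (h : IsBihom F p r) (hp : (g : ℤ) < p) :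
    F ∈ relations g := by
  refine Submodule.span_le.2 ?_ h.mem_span
  rintro _ ⟨m, ⟨h1, -⟩, rfl⟩
  exact mono_mem_relations (by omega)

theorem lt_weight_of_ne_one {m : ℕ+ →₀ ℕ} {n : ℕ+} (hn : n ≠ 1) (h : m n ≠ 0) :
    m 1 < Finsupp.weight deg m := by
  have h2 : m 1 + m n ≤ Finsupp.weight deg m := by
    rw [Finsupp.weight_apply, Finsupp.sum_of_support_subset (s := insert 1 (insert n m.support)) _
      (fun i hi => by simp at hi; simp [hi]) _ (by simp)]
    rw [← Finset.sum_pair (f := fun i => m i) hn.symm]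
    refine (Finset.sum_le_sum fun i _ => ?_).trans (Finset.sum_le_sum_of_subset (f := fun i =>
      m i • deg i) ?_)
    · exact Nat.le_mul_of_pos_right (m i) i.pos
    · intro i hi
      simp only [Finset.mem_insert, Finset.mem_singleton] at hi ⊢
      tauto
  omega

theorem exists_ne_one_of_lt_weight {m : ℕ+ →₀ ℕ} (h : m 1 < Finsupp.weight deg m) :
    ∃ n, n ≠ 1 ∧ m n ≠ 0 := by
  by_contra! h'
  have : m = Finsupp.single 1 (m 1) := by
    ext n
    by_cases hn : n = 1
    · subst hn; simp
    · rw [h' n hn, Finsupp.single_eq_of_ne hn]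
  rw [this] at h
  simp [Finsupp.weight_single, deg] at h

theorem IsBihom.D_pow_mem_relations {g : ℕ} {F : V} {r : ℤ} (h : IsBihom F g r)
    (hF : F ∈ higher) (d : ℕ) : (JacTaut.D g ^ d) F ∈ relations g := by
  have : F ∈ Submodule.span ℚ (mono '' {m | Finsupp.weight deg m = g ∧ m 1 < g}) := by
    refine mem_span_mono fun m hm => ?_
    have h1 := (h.of_coeff hm).1
    obtain ⟨n, hn, hmn⟩ := mem_higher_iff.1 hF m hm
    have h2 := lt_weight_of_ne_one hn hmn
    exact ⟨by exact_mod_cast h1, by omega⟩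
  have hle : Submodule.span ℚ (mono '' {m | Finsupp.weight deg m = g ∧ m 1 < g}) ≤
      (relations g).comap (JacTaut.D g ^ d) := by
    refine Submodule.span_le.2 ?_
    rintro _ ⟨m, ⟨h1, h2⟩, rfl⟩
    exact Submodule.subset_span (Or.inr ⟨d, m, h1, h2, rfl⟩)
  exact hle this

/-- Only degree `g + 1` is delicate, as `D` then lands in degree `g`. Monomials containing some
`x_n` with `n ≠ 1` land in `higher`; the remaining one, `x₁ ^ (g + 1)`, is killed by `D` because its
weight sum is zero. -/
theorem D_mono_mem_relations {g : ℕ} {m : ℕ+ →₀ ℕ} (h : g < Finsupp.weight deg m) :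
    D g (mono m) ∈ relations g := by
  have hb := (isBihom_mono m).D g
  by_cases h1 : g + 1 < Finsupp.weight deg m
  · exact hb.mem_relations (by omega)
  · have h2 : Finsupp.weight deg m = g + 1 := by omega
    by_cases h3 : ∃ n, n ≠ 1 ∧ m n ≠ 0
    · obtain ⟨n, hn, hmn⟩ := h3
      obtain ⟨m', h⟩ := exists_mono_eq_X_mul hmn
      rw [h2, h] at hb
      rw [h]
      exact IsBihom.D_pow_mem_relations (g := g) (d := 0) (by simpa using hb)
        (D_X_mul_mem_higher g hn _)
    · push Not at h3
      have : m = Finsupp.single 1 (g + 1) := by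
        have : m = Finsupp.single 1 (m 1) := by
          ext n
          by_cases hn : n = 1
          · subst hn; simp
          · rw [h3 n hn, Finsupp.single_eq_of_ne hn]
        rw [this] at h2
        rw [this]
        rw [show m 1 = g + 1 by simpa [Finsupp.weight_single, deg] using h2]
      have e : mono m = X 1 ^ (g + 1) * 1 := by rw [this, mul_one, X_pow_eq_monomial]; rfl
      rw [e, D_X_one_pow_mul g g isBihom_one, D_one]
      simp

theorem D_mem_relations {g : ℕ} {F : V} (hF : F ∈ relations g) : D g F ∈ relations g := by
  have : relations g ≤ (relations g).comap (D g) := by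
    refine Submodule.span_le.2 ?_
    rintro F (⟨n, hn, hF⟩ | ⟨d, m, h1, h2, rfl⟩)
    · have : F ∈ Submodule.span ℚ (mono '' {m | Finsupp.weight deg m = n}) :=
        mem_span_mono fun m hm => hF hm
      refine (Submodule.span_le (p := (relations g).comap (D g))).2 ?_ this
      rintro _ ⟨m, rfl, rfl⟩
      exact D_mono_mem_relations hn
    · refine Submodule.subset_span (Or.inr ⟨d + 1, m, h1, h2, ?_⟩)
      rw [pow_succ', Module.End.mul_apply]
  exact this hF

theorem D_pow_mem_relations {g : ℕ} {F : V} (hF : F ∈ relations g) (d : ℕ) :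
    (D g ^ d) F ∈ relations g := by
  induction d with
  | zero => simpa using hF
  | succ d ih => rw [pow_succ', Module.End.mul_apply]; exact D_mem_relations ih

/-- In degree `g`, a polynomial without pure power of `x₁` lies in the image of `D`. -/
theorem IsBihom.exists_D_eq {g : ℕ} {F : V} {r : ℕ} (h : IsBihom F g r) (hF : F ∈ higher) :
    ∃ G : V, IsBihom G (g + 1) (r + 1) ∧ JacTaut.D g G = F := by
  -- Ascent from `x₁^r D^r F` to `F`. The start is zero: `D^r F` has no factors left, yet lies in
  -- `higher`. By `D_X_one_pow_mul`, `x₁^j D^j F` and `x₁^(j+1) D^(j+1) F` are proportional modulo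
  -- the image of `D`, with a nonzero factor.
  suffices key : ∀ k ≤ r, ∃ G : V, IsBihom G (g + 1) (r + 1) ∧
      JacTaut.D g G = X 1 ^ (r - k) * (JacTaut.D g ^ (r - k)) F by
    simpa using key r le_rfl
  intro k
  induction k with
  | zero =>
    intro _
    refine ⟨0, isBihom_zero _ _, ?_⟩
    have h0 := h.D_pow g r
    rw [sub_self] at h0
    rw [Nat.sub_zero, h0.eq_zero_of_mem_higher (D_pow_mem_higher g r hF)]
    simp
  | succ k ih =>
    intro hk
    obtain ⟨G, hG, hDG⟩ := ih (by omega)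
    obtain ⟨j, hj⟩ : ∃ j, r = j + (k + 1) := ⟨r - (k + 1), by omega⟩
    have e1 : r - k = j + 1 := by omega
    have e2 : r - (k + 1) = j := by omega
    rw [e1] at hDG
    rw [e2]
    have hj' := h.D_pow g j
    have hform := D_X_one_pow_mul g j hj'
    have hc : (((j : ℚ) + 1) * (((g - j : ℤ) : ℚ) + ((r - j : ℤ) : ℚ) - g + j)) =
        ((j : ℚ) + 1) * (k + 1) := by
      rw [hj]; push_cast; ring
    rw [hc] at hform
    have hne : ((j : ℚ) + 1) * (k + 1) ≠ 0 := by positivity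
    refine ⟨(((j : ℚ) + 1) * (k + 1))⁻¹ • (X 1 ^ (j + 1) * (JacTaut.D g ^ j) F - G), ?_, ?_⟩
    · refine IsBihom.smul (IsBihom.sub ?_ hG) _
      have hX : ∀ i : ℕ, IsBihom (X 1 ^ i * (JacTaut.D g ^ j) F) (g - j + i) (r - j + i) := by
        intro i
        induction i with
        | zero => simpa using hj'
        | succ i ih =>
          rw [pow_succ', mul_assoc]
          convert ih.X_mul 1 using 1 <;> push_cast <;> ring
      convert hX (j + 1) using 1 <;> push_cast <;> ring
    · rw [map_smul, map_sub, hform, hDG, ← Module.End.mul_apply, ← pow_succ', add_sub_cancel_left,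
        inv_smul_smul₀ hne]

/-- A simpler generating set: by `IsBihom.exists_D_eq` a generator `D^d` of a degree `g` monomial is
`D^(d+1)` of a polynomial of degree `g + 1`. -/
theorem relations_le {g : ℕ} {T : Submodule ℚ V}
    (h : ∀ (d : ℕ) (F : V) (p r : ℤ), IsBihom F p r → (g : ℤ) < p → (D g ^ d) F ∈ T) :
    relations g ≤ T := by
  refine Submodule.span_le.2 ?_
  rintro F (⟨n, hn, hF⟩ | ⟨d, m, h1, h2, rfl⟩)
  · have : F ∈ Submodule.span ℚ (mono '' {m | Finsupp.weight deg m = n}) :=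
      mem_span_mono fun m hm => hF hm
    refine Submodule.span_le.2 ?_ this
    rintro _ ⟨m, rfl, rfl⟩
    exact h 0 _ _ _ (isBihom_mono m) (by exact_mod_cast hn)
  · rw [← h1] at h2
    obtain ⟨n, hn, hmn⟩ := exists_ne_one_of_lt_weight h2
    have hb := isBihom_mono m
    rw [h1] at hb
    have hmem : mono m ∈ higher := by
      obtain ⟨m', h⟩ := exists_mono_eq_X_mul hmn
      rw [h]
      exact Ideal.mul_mem_right _ _ (X_mem_higher hn)
    obtain ⟨G, hG, hDG⟩ := hb.exists_D_eq hmem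
    have : (D g ^ d) (monomial m 1) = (D g ^ (d + 1)) G := by
      rw [pow_succ, Module.End.mul_apply, hDG]; rfl
    rw [SetLike.mem_coe, this]
    exact h _ _ _ _ hG (by omega)

/-- By `D_gen`, moving `gen a b` past one `D` costs only a term `gen (a + 1) (b - 1)` with the same
`a + b`. For `d = 0` the degree drops by at most one, and if it reaches `g` the result is in
`higher`. -/
theorem IsBihom.gen_D_pow_mem_relations {g : ℕ} {F : V} {p r : ℤ} (h : IsBihom F p r)
    (hp : (g : ℤ) < p) (d : ℕ) : ∀ a b : ℕ, 3 ≤ a + b →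
      JacTaut.gen a b ((JacTaut.D g ^ d) F) ∈ relations g := by
  induction d with
  | zero =>
    intro a b hab
    have hb := h.gen (a := a) (b := b) (by omega)
    rw [pow_zero, Module.End.one_apply]
    by_cases hlt : (g : ℤ) < p + (b - 1)
    · exact hb.mem_relations hlt
    · have : p + ((b : ℤ) - 1) = g := by omega
      rw [this] at hb
      exact hb.D_pow_mem_relations (gen_mem_higher _ _ _ hab) 0
  | succ d ih =>
    intro a b hab
    have := D_gen g hab ((JacTaut.D g ^ d) F)
    rw [← Module.End.mul_apply (JacTaut.D g) (JacTaut.D g ^ d), ← pow_succ',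
      ← sub_eq_iff_eq_add] at this
    rw [← this]
    refine sub_mem (D_mem_relations (ih a b hab)) ?_
    rcases b with _ | b
    · simp
    · exact Submodule.smul_mem _ _ (ih _ _ (by omega))

theorem IsBihom.X_one_mul_D_pow_mem_relations {g : ℕ} {F : V} {p r : ℤ} (h : IsBihom F p r)
    (hp : (g : ℤ) < p) (d : ℕ) : X 1 * (JacTaut.D g ^ d) F ∈ relations g := by
  induction d with
  | zero => exact (h.X_mul 1).mem_relations (by simp; omega)
  | succ d ih =>
    have := D_X_one_mul g ((JacTaut.D g ^ d) F)
    rw [← Module.End.mul_apply (JacTaut.D g), ← pow_succ', ← sub_eq_iff_eq_add] at this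
    rw [← this, (h.D_pow g d).weightOp]
    exact sub_mem (D_mem_relations ih)
      (Submodule.smul_mem _ _ (JacTaut.D_pow_mem_relations (h.mem_relations hp) d))

theorem gen_mem_relations {g a b : ℕ} (hab : 3 ≤ a + b) {F : V} (hF : F ∈ relations g) :
    gen a b F ∈ relations g :=
  relations_le (T := (relations g).comap (gen a b))
    (fun d _ _ _ h hp => h.gen_D_pow_mem_relations hp d a b hab) hF

theorem gen_zero_succ (m : ℕ+) (F : V) : gen 0 (m + 1) F = (((m : ℕ) + 1)! : ℚ) • (X m * F) := by
  rw [gen_zero, Nat.add_sub_cancel, x_coe, smul_mul_assoc]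

theorem X_mul_mem_relations {g : ℕ} (n : ℕ+) {F : V} (hF : F ∈ relations g) :
    X n * F ∈ relations g := by
  by_cases hn : n = 1
  · subst hn
    exact relations_le (T := (relations g).comap (LinearMap.mulLeft ℚ (X 1)))
      (fun d _ _ _ h hp => h.X_one_mul_D_pow_mem_relations hp d) hF
  · have h2 : 1 < n := lt_of_le_of_ne one_le (Ne.symm hn)
    have h3 : 1 < (n : ℕ) := h2
    have := gen_mem_relations (a := 0) (b := n + 1) (by omega) hF
    rw [gen_zero_succ] at this
    have h4 := Submodule.smul_mem _ (((n : ℕ) + 1)! : ℚ)⁻¹ this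
    rwa [inv_smul_smul₀ (by positivity)] at h4

/-- The subspace `relations g`, as an ideal. -/
noncomputable def relationsIdeal (g : ℕ) : Ideal V where
  __ := (relations g).toAddSubmonoid
  smul_mem' := by
    intro G F hF
    change G * F ∈ relations g
    induction G using induction_X_mul with
    | hadd G H hG hH => rw [add_mul]; exact add_mem hG hH
    | hsmul r G hG => rw [smul_mul_assoc]; exact Submodule.smul_mem _ _ hG
    | one => rwa [one_mul]
    | X_mul m G hG => rw [mul_assoc]; exact X_mul_mem_relations m hG

theorem mem_relationsIdeal {g : ℕ} {F : V} : F ∈ relationsIdeal g ↔ F ∈ relations g := Iff.rfl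

end Relations

/-! ### The commuting dual operators, divided powers of `x₁`, and the commutators `raise` and
`lower` -/

section DualOperators

/-- The operator that the Fourier transform makes out of the multiplication with `x_k`. -/
noncomputable def dual (g : ℕ) (k : ℕ+) : Module.End ℚ V := if k = 1 then D g else Dk (k + 1)

theorem dual_one (g : ℕ) : dual g 1 = D g := if_pos rfl

theorem dual_of_ne_one (g : ℕ) {k : ℕ+} (hk : k ≠ 1) (F : V) :
    dual g k F = (1 / (((k : ℕ) + 1)! : ℚ)) • gen (k + 1) 0 F := by
  rw [dual, if_neg hk, Dk_eq]; rfl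

theorem one_lt_of_ne_one {k : ℕ+} (hk : k ≠ 1) : 1 < (k : ℕ) :=
  lt_of_le_of_ne (α := ℕ+) one_le hk.symm

theorem gen_dual_comm (g : ℕ) {a : ℕ} (ha : 3 ≤ a) (k : ℕ+) (F : V) :
    gen a 0 (dual g k F) = dual g k (gen a 0 F) := by
  by_cases hk : k = 1
  · subst hk
    rw [dual_one, D_gen g (by omega)]
    simp
  · have := one_lt_of_ne_one hk
    simp only [dual_of_ne_one g hk, map_smul]
    rw [gen_comm (by omega) (by omega)]
    simp

theorem dual_comm (g : ℕ) (j k : ℕ+) (F : V) :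
    dual g j (dual g k F) = dual g k (dual g j F) := by
  by_cases hj : j = 1
  · by_cases hk : k = 1
    · rw [hj, hk]
    · have := one_lt_of_ne_one hk
      rw [dual_of_ne_one g hk, dual_of_ne_one g hk, map_smul, gen_dual_comm g (by omega)]
  · have := one_lt_of_ne_one hj
    rw [dual_of_ne_one g hj, dual_of_ne_one g hj, map_smul, gen_dual_comm g (by omega)]

theorem IsBihom.dual {F : V} {p r : ℤ} (h : IsBihom F p r) (g : ℕ) (k : ℕ+) :
    IsBihom (dual g k F) (p - 1) (r - (k : ℕ)) := by
  by_cases hk : k = 1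
  · subst hk
    rw [dual_one]
    simpa using h.D g
  · have := one_lt_of_ne_one hk
    rw [dual_of_ne_one g hk]
    refine IsBihom.smul ?_ _
    convert h.gen (a := k + 1) (b := 0) (by omega) using 1 <;> push_cast <;> ring

theorem dual_mem_relations {g : ℕ} (k : ℕ+) {F : V} (hF : F ∈ relations g) :
    dual g k F ∈ relations g := by
  by_cases hk : k = 1
  · subst hk
    rw [dual_one]
    exact D_mem_relations hF
  · have := one_lt_of_ne_one hk
    rw [dual_of_ne_one g hk]
    exact Submodule.smul_mem _ _ (gen_mem_relations (by omega) hF)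

/-- The divided power `x₁^[c] = x₁^c / c!`, which is `0` for negative `c`. -/
noncomputable def divPow (c : ℤ) : V := if c < 0 then 0 else (1 / (c.toNat ! : ℚ)) • X 1 ^ c.toNat

theorem divPow_natCast (c : ℕ) : divPow c = (1 / (c ! : ℚ)) • X 1 ^ c := by
  simp [divPow, show ¬ ((c : ℤ) < 0) by omega]

theorem divPow_of_neg {c : ℤ} (h : c < 0) : divPow c = 0 := if_pos h

theorem isBihom_divPow (c : ℤ) : IsBihom (divPow c) c c := by
  by_cases h : c < 0
  · rw [divPow_of_neg h]; exact isBihom_zero _ _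
  · lift c to ℕ using by omega
    rw [divPow_natCast]
    refine IsBihom.smul ?_ _
    induction c with
    | zero => simpa using isBihom_one
    | succ c ih =>
      rw [pow_succ']
      convert (ih (by omega)).X_mul 1 using 1 <;> push_cast <;> ring

theorem D_divPow (g : ℕ) (c : ℤ) : D g (divPow c) = ((c : ℚ) - 1 - g) • divPow (c - 1) := by
  rcases lt_trichotomy c 0 with h | h | h
  · rw [divPow_of_neg h, divPow_of_neg (by omega)]; simp
  · subst h
    rw [divPow_of_neg (show (0 : ℤ) - 1 < 0 by omega)]
    simp [divPow, D_one]
  · obtain ⟨n, rfl⟩ : ∃ n : ℕ, c = (n + 1 : ℕ) := ⟨(c - 1).toNat, by omega⟩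
    rw [show ((n + 1 : ℕ) : ℤ) - 1 = (n : ℕ) by push_cast; ring, divPow_natCast, divPow_natCast,
      map_smul, ← mul_one (X 1 ^ (n + 1)), D_X_one_pow_mul g n isBihom_one, D_one]
    simp only [mul_zero, zero_add, smul_smul, mul_one]
    congr 1
    rw [Nat.factorial_succ]
    have : (n ! : ℚ) ≠ 0 := by positivity
    push_cast
    field_simp
    ring

theorem D_pow_divPow (g n : ℕ) :
    (D g ^ n) (divPow g) = ((-1 : ℚ) ^ n * (n ! : ℚ)) • divPow ((g : ℤ) - n) := by
  induction n with
  | zero => simp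
  | succ n ih =>
    rw [pow_succ', Module.End.mul_apply, ih, map_smul, D_divPow, smul_smul, Nat.factorial_succ]
    rw [show (g : ℤ) - n - 1 = g - (n + 1 : ℕ) by push_cast; ring]
    congr 1
    push_cast
    ring

/-- The commutator of `D` with the multiplication by `x_k`. -/
noncomputable def raise (g : ℕ) (k : ℕ+) : Module.End ℚ V :=
  if k = 1 then weightOp g else (1 / ((k : ℕ) ! : ℚ)) • gen 1 k

/-- The commutator of the multiplication by `x₁` with `dual g k`. -/
noncomputable def lower (g : ℕ) (k : ℕ+) : Module.End ℚ V :=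
  if k = 1 then -weightOp g else -((1 / ((k : ℕ) ! : ℚ)) • gen k 1)

theorem D_X_mul_eq_raise (g : ℕ) (k : ℕ+) (F : V) :
    D g (X k * F) = X k * D g F + raise g k F := by
  by_cases hk : k = 1
  · subst hk; rw [D_X_one_mul, raise, if_pos rfl]
  · rw [D_X_mul, raise, if_neg hk, if_neg hk, sub_zero]; rfl

theorem X_one_mul_dual (g : ℕ) (k : ℕ+) (F : V) :
    X 1 * dual g k F = dual g k (X 1 * F) + lower g k F := by
  by_cases hk : k = 1
  · subst hk; rw [dual_one, D_X_one_mul, lower, if_pos rfl]; simp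
  · rw [dual_of_ne_one g hk, dual_of_ne_one g hk, gen_X_mul, lower, if_neg hk]
    simp only [Nat.add_sub_cancel, smul_add, smul_smul, mul_smul_comm, LinearMap.neg_apply,
      LinearMap.smul_apply, zero_add, PNat.one_coe, Nat.factorial_one]
    rw [Nat.factorial_succ, add_assoc, ← sub_eq_add_neg, ← sub_smul]
    have : ((k : ℕ) ! : ℚ) ≠ 0 := by positivity
    have e : (1 / (((k : ℕ) + 1) * (k : ℕ) ! : ℕ) * (((k : ℕ) + 1 : ℕ) / (1 : ℕ)) -
      1 / ((k : ℕ) ! : ℚ)) = 0 := by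
      push_cast; field_simp; ring
    rw [e, zero_smul, add_zero]

theorem choose_div {k j l : ℕ+} (hl : (l : ℕ) + 1 = k + j) :
    (((k : ℕ) + j).choose k : ℚ) =
      (((l : ℕ) + 1)! : ℚ) / (((k : ℕ) ! : ℚ) * ((j : ℕ) ! : ℚ)) := by
  rw [Nat.cast_choose ℚ (Nat.le_add_right _ _), Nat.add_sub_cancel_left, hl]

theorem raise_X_mul (g : ℕ) {k j l : ℕ+} (hl : (l : ℕ) + 1 = k + j) (F : V) :
    raise g k (X j * F) = X j * raise g k F +
      (((k : ℕ) + j).choose k : ℚ) • (X l * F) := by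
  by_cases hk : k = 1
  · subst hk
    obtain rfl : l = j := PNat.coe_injective (by simp at hl; omega)
    rw [raise, if_pos rfl, weightOp_X_mul]
    congr 2
    simp [add_comm]
  · simp only [raise, if_neg hk, LinearMap.smul_apply, gen_X_mul, Nat.sub_self, ← hl,
      gen_zero_succ, smul_add, mul_smul_comm, smul_smul]
    rw [hl, choose_div hl, hl]
    congr 2
    push_cast
    field_simp

/-- The mirror image of `raise_X_mul`, with the same binomial constant and `dual` in place of
multiplication. This match is what lets `S` exchange `raise` and `lower` modulo relations. -/
theorem lower_dual (g : ℕ) {k j l : ℕ+} (hl : (l : ℕ) + 1 = k + j) (F : V) :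
    lower g k (dual g j F) = dual g j (lower g k F) +
      (((k : ℕ) + j).choose k : ℚ) • dual g l F := by
  have hk0 : ((k : ℕ) ! : ℚ) ≠ 0 := by positivity
  have hj0 : ((j : ℕ) ! : ℚ) ≠ 0 := by positivity
  have hl0 : (((l : ℕ) + 1)! : ℚ) ≠ 0 := by positivity
  by_cases hk : k = 1
  · subst hk
    obtain rfl : l = j := PNat.coe_injective (by simp at hl; omega)
    simp only [lower, if_true, LinearMap.neg_apply, map_neg]
    by_cases hj : l = 1
    · subst hj
      rw [dual_one, weightOp_D]
      norm_num
      module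
    · have := one_lt_of_ne_one hj
      simp only [dual_of_ne_one g hj, weightOp_apply, map_smul, map_sub]
      rw [gen_comm (a := 1) (b := 1) (by norm_num) (by omega)]
      rw [show 1 + ((l : ℕ) + 1) - 1 = l + 1 by omega]
      simp
      module
  · have h1 := one_lt_of_ne_one hk
    have hl1 : l ≠ 1 := by
      rintro rfl
      have := j.pos
      simp at hl
      omega
    rw [choose_div hl]
    simp only [lower, if_neg hk, LinearMap.neg_apply, LinearMap.smul_apply, map_neg, map_smul,
      dual_of_ne_one g hl1]
    by_cases hj : j = 1
    · subst hj
      obtain rfl : l = k := PNat.coe_injective (by simpa using hl)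
      rw [dual_one, D_gen g (by omega)]
      simp only [Nat.sub_self, smul_add, smul_smul, neg_add, PNat.one_coe, Nat.factorial_one]
      rw [add_assoc, left_eq_add, ← neg_smul, ← add_smul]
      convert zero_smul ℚ _
      push_cast
      field_simp
      ring
    · have h2 := one_lt_of_ne_one hj
      simp only [dual_of_ne_one g hj, map_smul]
      rw [gen_comm (a := k) (b := 1) (by omega) (by omega),
        show (k : ℕ) + (j + 1) - 1 = l + 1 by omega]
      simp only [smul_add, smul_smul, neg_add, add_zero, Nat.sub_self, ← neg_smul]
      congr 2
      rw [Nat.factorial_succ]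
      push_cast
      field_simp
      ring

end DualOperators

/-! ### An Abel-Hurwitz identity for falling factorials -/

section Abel

open Finset

/-- The falling factorial `z (z - 1) ⋯ (z - k + 1)`. -/
def falling (z : ℚ) (k : ℕ) : ℚ := ∏ i ∈ range k, (z - i)

@[simp] theorem falling_zero (z : ℚ) : falling z 0 = 1 := by simp [falling]

theorem falling_succ (z : ℚ) (k : ℕ) : falling z (k + 1) = falling z k * (z - k) :=
  prod_range_succ _ _

theorem falling_succ' (z : ℚ) (k : ℕ) : falling z (k + 1) = z * falling (z - 1) k := by
  rw [falling, prod_range_succ', falling, mul_comm]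
  congr 1
  · simp
  · exact prod_congr rfl fun i _ => by push_cast; ring

theorem falling_add (z : ℚ) (j k : ℕ) : falling z (j + k) = falling z j * falling (z - j) k := by
  induction k with
  | zero => simp
  | succ k ih =>
    rw [← add_assoc, falling_succ, ih, falling_succ]
    push_cast
    ring

theorem falling_neg (u : ℚ) (k : ℕ) : falling (-u) k = (-1) ^ k * falling (u + k - 1) k := by
  induction k with
  | zero => simp
  | succ k ih =>
    rw [falling_succ, ih, falling_succ', pow_succ]
    rw [show u + (k + 1 : ℕ) - 1 - 1 = u + k - 1 by push_cast; ring]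
    push_cast
    ring

theorem falling_add_one_sub (z : ℚ) (k : ℕ) :
    falling (z + 1) k - falling z k = k * falling z (k - 1) := by
  cases k with
  | zero => simp
  | succ k =>
    rw [falling_succ', falling_succ, add_sub_cancel_right, Nat.add_sub_cancel]
    push_cast
    ring

theorem falling_natCast {n k : ℕ} (h : k ≤ n) : falling n k = (n ! : ℚ) / ((n - k)! : ℚ) := by
  induction k with
  | zero => simp [div_self (show (n ! : ℚ) ≠ 0 by positivity)]
  | succ k ih =>
    rw [falling_succ, ih (by omega), show n - k = n - (k + 1) + 1 by omega, Nat.factorial_succ]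
    have : (((n - (k + 1))! : ℕ) : ℚ) ≠ 0 := by positivity
    have h2 : ((n - (k + 1) : ℕ) : ℚ) + 1 ≠ 0 := by positivity
    have h1 : (n : ℚ) - k = ((n - (k + 1) : ℕ) : ℚ) + 1 := by
      rw [Nat.cast_sub h]; push_cast; ring
    rw [h1]
    push_cast
    field_simp

theorem falling_natCast_eq_zero {n k : ℕ} (h : n < k) : falling n k = 0 :=
  prod_eq_zero (mem_range.2 h) (sub_self _)

theorem exists_polynomial_falling (c : ℚ) (k : ℕ) :
    ∃ p : Polynomial ℚ, p.degree ≤ k ∧ ∀ z, p.eval z = falling (z + c) k := by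
  induction k with
  | zero => exact ⟨1, by simp [Polynomial.degree_one], by simp⟩
  | succ k ih =>
    obtain ⟨p, hp, hz⟩ := ih
    refine ⟨p * (Polynomial.X + Polynomial.C (c - k)), ?_, fun z => ?_⟩
    · refine (Polynomial.degree_mul_le _ _).trans ?_
      rw [Polynomial.degree_X_add_C]
      push_cast
      gcongr
    · rw [Polynomial.eval_mul, hz, falling_succ]
      simp
      ring_nf
      simp

variable {ι : Type*}

/-- The Abel-type product `w (w - 1 + ∑ ν) ⋯ (w - |B| + 1 + ∑ ν)` with `|B|` factors. -/
def abelProd (ν : ι → ℚ) (w : ℚ) (B : Finset ι) : ℚ :=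
  if #B = 0 then 1 else w * falling (w - 1 + ∑ i ∈ B, ν i) (#B - 1)

/-- After reversing signs the two strings of factors are consecutive and merge into one falling
factorial of length `#s - 1`, a polynomial in the sum over `A` of fixed degree. For empty `A` the
factor `w` is the last one of the first string. -/
theorem falling_neg_mul_abelProd (ν : ι → ℚ) (w : ℚ) {s A : Finset ι} (hA : A ⊆ s)
    (hs : s.Nonempty) :
    falling (-(w + ∑ i ∈ A, ν i)) (#s - #A) * abelProd ν w A =
      (-1) ^ #s * w * ((-1) ^ #A *
        falling (∑ i ∈ A, (ν i - 1) + (w + #s - 1)) (#s - 1)) := by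
  have hcard := card_le_card hA
  have hpos := hs.card_pos
  have hsum : ∑ i ∈ A, (ν i - 1) = ∑ i ∈ A, ν i - #A := by simp [sum_sub_distrib]
  set u := w + ∑ i ∈ A, ν i with hu
  have hsign : (-1 : ℚ) ^ (#s - #A) = (-1) ^ #s * (-1) ^ #A := by
    rw [← pow_add]
    refine (neg_one_pow_congr ?_)
    rw [Nat.even_sub hcard, Nat.even_add]
  rw [falling_neg, hsign, hsum, Nat.cast_sub hcard]
  rw [show ∑ i ∈ A, ν i - (#A : ℚ) + (w + #s - 1) = u + (#s - #A) - 1 by rw [hu]; ring]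
  rw [abelProd]
  split_ifs with h0
  · have hA0 : A = ∅ := card_eq_zero.1 h0
    have hu' : u = w := by rw [hu, hA0]; simp
    rw [h0, Nat.sub_zero, hu']
    obtain ⟨n, hn⟩ : ∃ n, #s = n + 1 := ⟨#s - 1, by omega⟩
    rw [hn, falling_succ]
    push_cast
    simp
    ring
  · rw [show #s - 1 = (#s - #A) + (#A - 1) by omega, falling_add, Nat.cast_sub hcard]
    rw [show u + ((#s : ℚ) - #A) - 1 - (#s - #A) = w - 1 + ∑ i ∈ A, ν i by rw [hu]; ring]
    ring

variable [DecidableEq ι]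

/-- The sum is an iterated finite difference, and each of the `#s` differences lowers the degree. -/
theorem sum_powerset_neg_one_pow_mul_eval (v : ι → ℚ) (s : Finset ι) :
    ∀ p : Polynomial ℚ, p.degree < #s →
      ∑ A ∈ s.powerset, (-1) ^ #A * p.eval (∑ i ∈ A, v i) = 0 := by
  induction s using Finset.induction_on with
  | empty =>
    intro p hp
    have : p = 0 := by
      rw [card_empty, Nat.cast_zero] at hp
      by_contra h
      exact absurd (Polynomial.zero_le_degree_iff.2 h) (not_le.2 hp)
    simp [this]
  | insert a s ha ih =>
    intro p hp
    rw [sum_powerset_insert ha, ← sum_add_distrib]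
    rw [← ih (p - Polynomial.taylor (v a) p) ?_]
    · refine sum_congr rfl fun A hA => ?_
      have haA : a ∉ A := fun h => ha (mem_powerset.1 hA h)
      rw [card_insert_of_notMem haA, sum_insert haA, Polynomial.eval_sub, Polynomial.taylor_eval,
        pow_succ, add_comm (v a)]
      ring
    · by_cases h0 : p = 0
      · simp [h0]
      · rw [card_insert_of_notMem ha] at hp
        have h1 := Polynomial.degree_sub_lt_left (q := Polynomial.taylor (v a) p)
          (Polynomial.degree_taylor _ _).symm h0 (Polynomial.leadingCoeff_taylor _ _).symm
        rw [Polynomial.degree_eq_natDegree h0] at h1 hp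
        have h2 : p.natDegree < #s + 1 := by exact_mod_cast hp
        exact h1.trans_le (by exact_mod_cast Nat.lt_succ_iff.1 h2)

theorem sum_powerset_sum_mem {M : Type*} [AddCommMonoid M] (s : Finset ι)
    (f : ι → Finset ι → M) :
    ∑ A ∈ s.powerset, ∑ a ∈ A, f a (A.erase a) =
      ∑ a ∈ s, ∑ A ∈ (s.erase a).powerset, f a A := by
  rw [sum_sigma', sum_sigma']
  refine sum_bij' (fun x _ => ⟨x.2, x.1.erase x.2⟩) (fun x _ => ⟨insert x.1 x.2, x.1⟩) ?_ ?_ ?_ ?_ ?_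
  · rintro ⟨A, a⟩ h
    simp only [mem_sigma, mem_powerset] at h ⊢
    exact ⟨h.1 h.2, erase_subset_erase _ h.1⟩
  · rintro ⟨a, A⟩ h
    simp only [mem_sigma, mem_powerset] at h ⊢
    exact ⟨insert_subset h.1 (h.2.trans (erase_subset _ _)), mem_insert_self _ _⟩
  · rintro ⟨A, a⟩ h
    simp only [mem_sigma, mem_powerset] at h
    simp [insert_erase h.2]
  · rintro ⟨a, A⟩ h
    simp only [mem_sigma, mem_powerset] at h
    have : a ∉ A := fun h' => by simpa using h.2 h'
    simp [erase_insert this]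
  · rintro ⟨A, a⟩ h
    rfl

/-- Both sides have the same difference under `y ↦ y + 1`, by induction on `s`, and both vanish at
`k = 0` for nonempty `s`. Integrality of `k` allows the induction in both directions from there. -/
theorem abel_sum_aux (ν : ι → ℚ) (w : ℚ) (s : Finset ι) : ∀ (k : ℤ) (y : ℚ),
    w + y + ∑ i ∈ s, ν i = k →
    ∑ A ∈ s.powerset, falling (∑ i ∈ A, ν i + y) #A * abelProd ν w (s \ A) = falling k #s := by
  induction s using Finset.strongInduction with
  | H s ih =>
  rcases s.eq_empty_or_nonempty with rfl | hs
  · intro k y _; simp [abelProd]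
  -- The factor `#A` from differencing a falling factorial is spread over the elements `a` of `A`;
  -- removing `a` and replacing `y` by `y + ν a` keeps the total `k`.
  have hdiff : ∀ (k : ℤ) (y : ℚ), w + y + ∑ i ∈ s, ν i = k →
      ∑ A ∈ s.powerset, falling (∑ i ∈ A, ν i + (y + 1)) #A * abelProd ν w (s \ A) -
      ∑ A ∈ s.powerset, falling (∑ i ∈ A, ν i + y) #A * abelProd ν w (s \ A) =
      falling (k + 1) #s - falling k #s := by
    intro k y hk
    rw [falling_add_one_sub, ← sum_sub_distrib]
    have h1 : ∀ A ∈ s.powerset,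
        falling (∑ i ∈ A, ν i + (y + 1)) #A * abelProd ν w (s \ A) -
        falling (∑ i ∈ A, ν i + y) #A * abelProd ν w (s \ A) =
        ∑ a ∈ A, falling (∑ i ∈ A.erase a, ν i + (y + ν a)) #(A.erase a) *
          abelProd ν w ((s.erase a) \ (A.erase a)) := by
      intro A hA
      rw [← sub_mul, ← add_assoc, falling_add_one_sub, mul_assoc, ← nsmul_eq_mul, ← sum_const]
      refine sum_congr rfl fun a ha => ?_
      rw [card_erase_of_mem ha, ← sum_erase_add _ _ ha]
      congr 2
      · ring
      · ext i
        simp only [mem_sdiff, mem_erase]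
        constructor
        · rintro ⟨h1, h2⟩
          exact ⟨⟨fun e => h2 (e ▸ ha), h1⟩, fun h => h2 h.2⟩
        · rintro ⟨⟨h1, h2⟩, h3⟩
          exact ⟨h2, fun h => h3 ⟨h1, h⟩⟩
    rw [sum_congr rfl h1, sum_powerset_sum_mem s fun a A =>
      falling (∑ i ∈ A, ν i + (y + ν a)) #A * abelProd ν w ((s.erase a) \ A),
      ← nsmul_eq_mul, ← sum_const]
    refine sum_congr rfl fun a ha => ?_
    rw [ih _ (erase_ssubset ha) k (y + ν a), card_erase_of_mem ha]
    rw [← hk, ← sum_erase_add _ _ ha]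
    ring
  have hbase : ∀ y : ℚ, w + y + ∑ i ∈ s, ν i = 0 →
      ∑ A ∈ s.powerset, falling (∑ i ∈ A, ν i + y) #A * abelProd ν w (s \ A) = 0 := by
    intro y hy
    obtain ⟨p, hp, hz⟩ := exists_polynomial_falling (w + #s - 1) (#s - 1)
    have hsum := sum_powerset_neg_one_pow_mul_eval (fun i => ν i - 1) s p
      (hp.trans_lt (by exact_mod_cast Nat.sub_lt hs.card_pos one_pos))
    have h2 : ∑ A ∈ s.powerset, falling (∑ i ∈ A, ν i + y) #A * abelProd ν w (s \ A) =
        ∑ A ∈ s.powerset, falling (∑ i ∈ s \ A, ν i + y) #(s \ A) * abelProd ν w A := by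
      refine sum_bij' (fun A _ => s \ A) (fun A _ => s \ A) ?_ ?_ ?_ ?_ ?_
      · intro A _; simp
      · intro A _; simp
      · intro A hA; simpa using mem_powerset.1 hA
      · intro A hA; simpa using mem_powerset.1 hA
      · intro A hA
        simp only [Finset.sdiff_sdiff_eq_self (mem_powerset.1 hA)]
    rw [h2]
    have h3 : ∀ A ∈ s.powerset,
        falling (∑ i ∈ s \ A, ν i + y) #(s \ A) * abelProd ν w A =
        (-1) ^ #s * w * ((-1) ^ #A * p.eval (∑ i ∈ A, (ν i - 1))) := by
      intro A hA
      have hA' := mem_powerset.1 hA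
      rw [hz, ← falling_neg_mul_abelProd ν w hA' hs, card_sdiff_of_subset hA']
      congr 2
      rw [← sum_sdiff hA'] at hy
      linarith
    rw [sum_congr rfl h3, ← mul_sum, hsum, mul_zero]
  intro k
  induction k using Int.induction_on with
  | zero =>
    intro y hy
    rw [Int.cast_zero] at hy ⊢
    rw [hbase y hy]
    have := hs.card_pos
    exact (falling_natCast_eq_zero (n := 0) this).symm.trans (by simp)
  | succ k ihk =>
    intro y hy
    push_cast at hy
    have h1 := ihk (y - 1) (by push_cast; linarith)
    have h2 := hdiff k (y - 1) (by push_cast; linarith)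
    rw [sub_add_cancel, h1] at h2
    push_cast at h2 ⊢
    linarith
  | pred k ihk =>
    intro y hy
    push_cast at hy
    have h1 := ihk (y + 1) (by push_cast; linarith)
    have h2 := hdiff (-k - 1) y (by push_cast; linarith)
    rw [h1] at h2
    push_cast at h2 ⊢
    rw [sub_add_cancel] at h2
    linarith

/-- An identity of Abel and Hurwitz, for falling factorials. -/
theorem abel_sum (ν : ι → ℤ) (w y : ℤ) (s : Finset ι) :
    ∑ A ∈ s.powerset, falling (∑ i ∈ A, (ν i : ℚ) + y) #A * abelProd (fun i => (ν i : ℚ)) w (s \ A) =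
      falling (w + y + ∑ i ∈ s, (ν i : ℚ)) #s := by
  rw [abel_sum_aux (fun i => (ν i : ℚ)) w s (w + y + ∑ i ∈ s, ν i) y (by push_cast; ring)]
  push_cast
  rfl

end Abel

/-! ### Set partitions and weighted sums over them -/

section Partitions

open Finset

variable {ι : Type*} [DecidableEq ι]

/-- The partitions of a finite set into nonempty subsets. -/
def partitions (s : Finset ι) : Finset (Finset (Finset ι)) :=
  (univ : Finset (Finpartition s)).image fun P => P.parts

theorem mem_partitions {s : Finset ι} {π : Finset (Finset ι)} :
    π ∈ partitions s ↔
      (∀ A ∈ π, A.Nonempty) ∧ (π : Set (Finset ι)).PairwiseDisjoint id ∧ π.biUnion id = s := by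
  simp only [partitions, mem_image, mem_univ, true_and]
  constructor
  · rintro ⟨P, rfl⟩
    exact ⟨fun A hA => P.nonempty_of_mem_parts hA, P.disjoint, P.biUnion_parts⟩
  · rintro ⟨h1, h2, h3⟩
    refine ⟨⟨π, ?_, ?_, fun h => ?_⟩, rfl⟩
    · exact h2.supIndep
    · rw [sup_eq_biUnion, h3]
    · simpa using h1 _ h

theorem sum_partitions {M : Type*} [AddCommMonoid M] (s : Finset ι)
    (f : Finset (Finset ι) → M) :
    ∑ π ∈ partitions s, f π = ∑ P : Finpartition s, f P.parts :=
  sum_image fun _ _ _ _ h => Finpartition.ext h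

theorem partitions_empty : partitions (∅ : Finset ι) = {∅} := by
  ext π
  rw [mem_partitions, mem_singleton]
  constructor
  · rintro ⟨h1, -, h3⟩
    refine eq_empty_of_forall_notMem fun A hA => ?_
    obtain ⟨i, hi⟩ := h1 A hA
    have : i ∈ π.biUnion id := mem_biUnion.2 ⟨A, hA, hi⟩
    simp [h3] at this
  · rintro rfl; simp

theorem subset_of_mem_partitions {s : Finset ι} {π : Finset (Finset ι)} (h : π ∈ partitions s)
    {A : Finset ι} (hA : A ∈ π) : A ⊆ s := by
  rw [← (mem_partitions.1 h).2.2]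
  exact subset_biUnion_of_mem id hA

theorem sum_sum_of_mem_partitions {M : Type*} [AddCommMonoid M] {s : Finset ι}
    {π : Finset (Finset ι)} (h : π ∈ partitions s) (f : ι → M) :
    ∑ A ∈ π, ∑ i ∈ A, f i = ∑ i ∈ s, f i := by
  obtain ⟨-, h2, h3⟩ := mem_partitions.1 h
  rw [← h3, sum_biUnion h2]
  rfl

theorem prod_prod_of_mem_partitions {M : Type*} [CommMonoid M] {s : Finset ι}
    {π : Finset (Finset ι)} (h : π ∈ partitions s) (f : ι → M) :
    ∏ A ∈ π, ∏ i ∈ A, f i = ∏ i ∈ s, f i := by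
  obtain ⟨-, h2, h3⟩ := mem_partitions.1 h
  rw [← h3, prod_biUnion h2]
  rfl

theorem disjoint_of_mem_partitions {s t : Finset ι} (hst : Disjoint s t)
    {π ρ : Finset (Finset ι)} (hπ : π ∈ partitions s) (hρ : ρ ∈ partitions t) : Disjoint π ρ := by
  rw [disjoint_left]
  intro A hA hA'
  obtain ⟨i, hi⟩ := (mem_partitions.1 hπ).1 A hA
  exact disjoint_left.1 hst (subset_of_mem_partitions hπ hA hi) (subset_of_mem_partitions hρ hA' hi)

theorem union_mem_partitions {s t : Finset ι} (hst : Disjoint s t)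
    {π ρ : Finset (Finset ι)} (hπ : π ∈ partitions s) (hρ : ρ ∈ partitions t) :
    π ∪ ρ ∈ partitions (s ∪ t) := by
  obtain ⟨h1, h2, h3⟩ := mem_partitions.1 hπ
  obtain ⟨k1, k2, k3⟩ := mem_partitions.1 hρ
  refine mem_partitions.2 ⟨fun A hA => (mem_union.1 hA).elim (h1 A) (k1 A), ?_, ?_⟩
  · rw [coe_union, Set.pairwiseDisjoint_union]
    refine ⟨h2, k2, fun A hA B hB _ => ?_⟩
    exact disjoint_of_subset_left (subset_of_mem_partitions hπ hA)
      (disjoint_of_subset_right (subset_of_mem_partitions hρ hB) hst)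
  · rw [union_biUnion, h3, k3]

theorem subset_mem_partitions {s : Finset ι} {π Q : Finset (Finset ι)} (hπ : π ∈ partitions s)
    (hQ : Q ⊆ π) : Q ∈ partitions (Q.biUnion id) := by
  obtain ⟨h1, h2, -⟩ := mem_partitions.1 hπ
  exact mem_partitions.2 ⟨fun A hA => h1 A (hQ hA), h2.subset (coe_subset.2 hQ), rfl⟩

theorem biUnion_sdiff_of_mem_partitions {s : Finset ι} {π Q : Finset (Finset ι)}
    (hπ : π ∈ partitions s) (hQ : Q ⊆ π) : (π \ Q).biUnion id = s \ Q.biUnion id := by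
  obtain ⟨-, h2, h3⟩ := mem_partitions.1 hπ
  ext i
  simp only [mem_biUnion, mem_sdiff, id, ← h3]
  constructor
  · rintro ⟨A, ⟨hA, hAQ⟩, hi⟩
    refine ⟨⟨A, hA, hi⟩, ?_⟩
    rintro ⟨B, hB, hiB⟩
    have : A = B := by
      by_contra hne
      exact disjoint_left.1 (h2 hA (hQ hB) hne) hi hiB
    exact hAQ (this ▸ hB)
  · rintro ⟨⟨A, hA, hi⟩, hn⟩
    exact ⟨A, ⟨hA, fun h => hn ⟨A, h, hi⟩⟩, hi⟩

theorem singleton_mem_partitions {A : Finset ι} (hA : A.Nonempty) : {A} ∈ partitions A :=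
  mem_partitions.2 ⟨by simpa using hA, by simp, by simp⟩

/-- Splitting the blocks of a partition into two classes. -/
theorem sum_partitions_powerset {M : Type*} [AddCommMonoid M] (s : Finset ι)
    (f : Finset (Finset ι) → Finset (Finset ι) → M) :
    ∑ π ∈ partitions s, ∑ Q ∈ π.powerset, f Q (π \ Q) =
      ∑ A ∈ s.powerset, ∑ π ∈ partitions A, ∑ ρ ∈ partitions (s \ A), f π ρ := by
  simp only [sum_sigma']
  refine sum_bij' (fun x _ => ⟨x.2.biUnion id, x.2, x.1 \ x.2⟩)
    (fun x _ => ⟨x.2.1 ∪ x.2.2, x.2.1⟩) ?_ ?_ ?_ ?_ ?_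
  · rintro ⟨π, Q⟩ h
    simp only [mem_sigma, mem_powerset] at h ⊢
    obtain ⟨hπ, hQ⟩ := h
    refine ⟨?_, subset_mem_partitions hπ hQ, ?_⟩
    · rw [← (mem_partitions.1 hπ).2.2]
      exact biUnion_subset_biUnion_of_subset_left _ hQ
    · rw [← biUnion_sdiff_of_mem_partitions hπ hQ]
      exact subset_mem_partitions hπ sdiff_subset
  · rintro ⟨A, π, ρ⟩ h
    simp only [mem_sigma, mem_powerset] at h ⊢
    obtain ⟨hA, hπ, hρ⟩ := h
    refine ⟨?_, subset_union_left⟩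
    have := union_mem_partitions disjoint_sdiff hπ hρ
    rwa [union_sdiff_of_subset hA] at this
  · rintro ⟨π, Q⟩ h
    simp only [mem_sigma, mem_powerset] at h
    simp [union_sdiff_of_subset h.2]
  · rintro ⟨A, π, ρ⟩ h
    simp only [mem_sigma, mem_powerset] at h
    obtain ⟨hA, hπ, hρ⟩ := h
    have h1 : (π ∪ ρ) \ π = ρ :=
      union_sdiff_cancel_left (disjoint_of_mem_partitions disjoint_sdiff hπ hρ)
    simp [h1, (mem_partitions.1 hπ).2.2]
  · rintro ⟨π, Q⟩ h
    rfl

theorem insert_mem_partitions {s A : Finset ι} {a : ι} (ha : a ∉ s) (hA : A ⊆ s)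
    {ρ : Finset (Finset ι)} (hρ : ρ ∈ partitions (s \ A)) :
    insert (insert a A) ρ ∈ partitions (insert a s) := by
  have hd : Disjoint (insert a A) (s \ A) := by
    rw [disjoint_insert_left]
    exact ⟨fun h => ha (mem_sdiff.1 h).1, disjoint_sdiff⟩
  have := union_mem_partitions hd (singleton_mem_partitions (insert_nonempty a A)) hρ
  rwa [insert_union, union_sdiff_of_subset hA] at this

theorem insert_notMem_of_mem_partitions {s A : Finset ι} {a : ι} (ha : a ∉ s)
    {ρ : Finset (Finset ι)} (hρ : ρ ∈ partitions (s \ A)) : insert a A ∉ ρ := fun h =>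
  ha (mem_sdiff.1 (subset_of_mem_partitions hρ h (mem_insert_self a A))).1

/-- Summing over the block of a distinguished element. -/
theorem sum_partitions_insert {M : Type*} [AddCommMonoid M] {s : Finset ι} {a : ι} (ha : a ∉ s)
    (f : Finset (Finset ι) → M) :
    ∑ π ∈ partitions (insert a s), f π =
      ∑ A ∈ s.powerset, ∑ ρ ∈ partitions (s \ A), f (insert (insert a A) ρ) := by
  rw [sum_sigma']
  symm
  refine sum_bij (fun x _ => insert (insert a x.1) x.2) ?_ ?_ ?_ ?_
  · rintro ⟨A, ρ⟩ h
    simp only [mem_sigma, mem_powerset] at h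
    exact insert_mem_partitions ha h.1 h.2
  · rintro ⟨A, ρ⟩ h ⟨B, τ⟩ h' heq
    simp only [mem_sigma, mem_powerset] at h h' heq
    have hA : insert a A = insert a B := by
      have : insert a A ∈ insert (insert a B) τ := heq ▸ mem_insert_self _ _
      rcases mem_insert.1 this with h1 | h1
      · exact h1
      · exact absurd (mem_sdiff.1 (subset_of_mem_partitions h'.2 h1 (mem_insert_self a A))).1 ha
    have hAB : A = B := by
      rw [← erase_insert (fun h1 => ha (h.1 h1)), hA, erase_insert (fun h1 => ha (h'.1 h1))]
    subst hAB
    have : ρ = τ := by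
      rw [← erase_insert (insert_notMem_of_mem_partitions ha h.2), heq,
        erase_insert (insert_notMem_of_mem_partitions ha h'.2)]
    rw [this]
  · intro π hπ
    obtain ⟨h1, h2, h3⟩ := mem_partitions.1 hπ
    have : a ∈ π.biUnion id := h3 ▸ mem_insert_self a s
    obtain ⟨J, hJ, haJ⟩ := mem_biUnion.1 this
    have hJ' : insert a (J.erase a) = J := insert_erase haJ
    refine ⟨⟨J.erase a, π.erase J⟩, ?_, ?_⟩
    · simp only [mem_sigma, mem_powerset]
      refine ⟨?_, ?_⟩
      · rw [← erase_insert ha]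
        exact erase_subset_erase _ (subset_of_mem_partitions hπ hJ)
      · have hJs : {J} ⊆ π := singleton_subset_iff.2 hJ
        have h4 := subset_mem_partitions hπ (sdiff_subset (s := π) (t := {J}))
        rw [biUnion_sdiff_of_mem_partitions hπ hJs, singleton_biUnion, id,
          sdiff_singleton_eq_erase] at h4
        convert h4 using 2
        ext i
        simp only [mem_sdiff, mem_erase, mem_insert]
        constructor
        · rintro ⟨hi, hn⟩
          exact ⟨Or.inr hi, fun hiJ => hn ⟨fun e => ha (e ▸ hi), hiJ⟩⟩
        · rintro ⟨rfl | hi, hn⟩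
          · exact absurd haJ hn
          · exact ⟨hi, fun hiJ => hn hiJ.2⟩
    · simp only [hJ', insert_erase hJ]
  · rintro ⟨A, ρ⟩ h
    rfl

/-- Split off the block `insert a A` of a chosen element `a`. The other blocks sum to an Abel
product with `z - 1`, and the sum over `A` is `abel_sum` with `y = ν a`. -/
theorem sum_partitions_falling (ν : ι → ℤ) (s : Finset ι) : ∀ z : ℤ,
    ∑ π ∈ partitions s, falling z #π * ∏ I ∈ π, falling (∑ i ∈ I, (ν i : ℚ)) (#I - 1) =
      abelProd (fun i => (ν i : ℚ)) z s := by
  induction s using Finset.strongInduction with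
  | H s ih =>
  intro z
  rcases s.eq_empty_or_nonempty with rfl | ⟨a, ha⟩
  · simp [partitions_empty, abelProd]
  obtain ⟨t, hat, rfl⟩ : ∃ t, a ∉ t ∧ insert a t = s := ⟨s.erase a, by simp, insert_erase ha⟩
  rw [sum_partitions_insert hat, abelProd, if_neg (by simp [card_insert_of_notMem hat]),
    card_insert_of_notMem hat, Nat.add_sub_cancel, sum_insert hat]
  have h1 := abel_sum ν (z - 1) (ν a) t
  push_cast at h1
  rw [show (z : ℚ) - 1 + (ν a + ∑ i ∈ t, (ν i : ℚ)) = z - 1 + ν a + ∑ i ∈ t, (ν i : ℚ) by ring,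
    ← h1, mul_sum]
  refine sum_congr rfl fun A hA => ?_
  have hA' := mem_powerset.1 hA
  have haA : a ∉ A := fun h => hat (hA' h)
  have h2 := ih (t \ A) (lt_of_le_of_lt (b := t) sdiff_subset (ssubset_insert hat)) (z - 1)
  push_cast at h2
  rw [← h2, mul_sum, mul_sum]
  refine sum_congr rfl fun ρ hρ => ?_
  have hn := insert_notMem_of_mem_partitions hat hρ
  rw [card_insert_of_notMem hn, prod_insert hn, card_insert_of_notMem haA, sum_insert haA,
    falling_succ', Nat.add_sub_cancel, add_comm (ν a : ℚ)]
  ring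

end Partitions

/-! ### The partition formula as a product of dual operators applied to `x₁^[g]` -/

section FourierFormula

open Finset

theorem X_one_mul_divPow (c : ℤ) : X 1 * divPow c = ((c : ℚ) + 1) • divPow (c + 1) := by
  rcases lt_trichotomy c (-1) with h | h | h
  · rw [divPow_of_neg (by omega), divPow_of_neg (by omega)]; simp
  · subst h; rw [divPow_of_neg (by omega)]; simp
  · lift c to ℕ using by omega
    rw [show (c : ℤ) + 1 = (c + 1 : ℕ) by push_cast; ring, divPow_natCast, divPow_natCast,
      mul_smul_comm, ← pow_succ', smul_smul, Nat.factorial_succ]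
    congr 1
    have : (c ! : ℚ) ≠ 0 := by positivity
    push_cast
    field_simp

theorem gen_divPow_natCast (c : ℕ) : ∀ a b : ℕ,
    gen a b (divPow c) = (((a + b)! : ℕ) : ℚ) • (x (a + b - 1) * divPow ((c : ℤ) - a)) := by
  induction c with
  | zero =>
    intro a b
    have h0 : divPow 0 = 1 := by simp [divPow]
    rw [Nat.cast_zero, h0]
    rcases a with _ | a
    · rw [gen_zero]; simp [h0]
    · rw [gen_succ_one, divPow_of_neg (by push_cast; omega)]; simp
  | succ c ih =>
    intro a b
    have hc : ((c : ℚ) + 1) ≠ 0 := by positivity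
    have h1 := X_one_mul_divPow c
    have h2 := gen_X_mul a b 1 (divPow c)
    have h3 := X_one_mul_divPow ((c : ℤ) - a)
    rw [h1, map_smul, ih] at h2
    have h4 : (a : ℚ) • gen (a - 1) (b + (1 : ℕ+)) (divPow c) =
        (a : ℚ) • (((a + b)! : ℕ) : ℚ) • (x (a + b - 1) * divPow ((c : ℤ) - a + 1)) := by
      rcases a with _ | a
      · simp
      · rw [ih, PNat.one_coe, show a + 1 - 1 + (b + 1) = a + 1 + b by omega]
        congr 4
        push_cast
        ring
    rw [PNat.one_coe, Nat.factorial_one, Nat.cast_one, div_one] at h2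
    rw [PNat.one_coe] at h4
    rw [h4, mul_smul_comm, mul_left_comm, h3, mul_smul_comm, smul_smul, smul_smul, ← add_smul] at h2
    rw [show ((c : ℤ) : ℚ) + 1 = (c : ℚ) + 1 by simp] at h2
    rw [show ((c + 1 : ℕ) : ℤ) - a = (c : ℤ) - a + 1 by push_cast; ring, Nat.cast_succ]
    refine smul_right_injective V hc ?_
    simp only
    rw [h2, smul_smul]
    congr 1
    push_cast
    ring

theorem gen_divPow (c : ℤ) (a b : ℕ) :
    gen a b (divPow c) = (((a + b)! : ℕ) : ℚ) • (x (a + b - 1) * divPow (c - a)) := by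
  by_cases h : c < 0
  · rw [divPow_of_neg h, divPow_of_neg (by omega)]; simp
  · lift c to ℕ using by omega
    exact gen_divPow_natCast c a b

/-- The action of `gen a b` on a product with variables. -/
theorem gen_mul_prod {κ : Type*} [DecidableEq κ] (G : V) (c : κ → ℚ) (d : κ → ℕ) (T : Finset κ)
    (hd : ∀ i ∈ T, 0 < d i) : ∀ a b : ℕ,
    gen a b (G * ∏ i ∈ T, c i • x (d i)) =
      ∑ Q ∈ T.powerset, (falling a #Q * ∏ i ∈ Q, c i / ((d i)! : ℚ)) •
        (gen (a - #Q) (b + ∑ i ∈ Q, d i) G * ∏ i ∈ T \ Q, c i • x (d i)) := by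
  induction T using Finset.induction_on with
  | empty => intro a b; simp
  | insert j T hj ih =>
    intro a b
    have ih := ih fun i hi => hd i (mem_insert_of_mem hi)
    rw [prod_insert hj, mul_left_comm, smul_mul_assoc, map_smul,
      gen_x_mul _ _ (hd j (mem_insert_self _ _)), sum_powerset_insert hj, smul_add]
    congr 1
    · rw [ih, mul_sum, smul_sum]
      refine sum_congr rfl fun Q hQ => ?_
      have hjQ : j ∉ Q := fun h => hj (mem_powerset.1 hQ h)
      rw [insert_sdiff_of_notMem _ hjQ, prod_insert fun h => hj (mem_sdiff.1 h).1]
      simp only [mul_smul_comm, smul_mul_assoc]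
      rw [smul_comm]
      congr 2
      ring
    · rw [ih, smul_smul, smul_sum]
      refine sum_congr rfl fun Q hQ => ?_
      have hjQ : j ∉ Q := fun h => hj (mem_powerset.1 hQ h)
      rw [insert_sdiff_insert, sdiff_insert_of_notMem hj, card_insert_of_notMem hjQ,
        prod_insert hjQ, sum_insert hjQ, smul_smul, ← add_assoc,
        show a - 1 - #Q = a - (#Q + 1) by omega]
      congr 1
      -- At `a = 0` both coefficients vanish, so the truncated subtraction does not matter.
      rcases a with _ | a
      · simp [falling_succ']
      · rw [falling_succ', Nat.add_sub_cancel]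
        push_cast
        rw [add_sub_cancel_right]
        ring

variable {ι : Type*}

/-- The multinomial coefficient of a block. -/
def blockCoeff (ν : ι → ℕ+) (I : Finset ι) : ℚ :=
  (((∑ i ∈ I, (ν i : ℕ))! : ℕ) : ℚ) / ∏ i ∈ I, (((ν i : ℕ)! : ℕ) : ℚ)

/-- The index of the variable attached to a block. -/
def blockIndex (ν : ι → ℕ+) (I : Finset ι) : ℕ := ∑ i ∈ I, (ν i : ℕ) + 1 - #I

theorem card_le_sum (ν : ι → ℕ+) (I : Finset ι) : #I ≤ ∑ i ∈ I, (ν i : ℕ) := by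
  rw [card_eq_sum_ones]
  exact sum_le_sum fun i _ => (ν i).pos

theorem blockIndex_add_card (ν : ι → ℕ+) (I : Finset ι) :
    blockIndex ν I + #I = ∑ i ∈ I, (ν i : ℕ) + 1 := by
  have := card_le_sum ν I
  unfold blockIndex
  omega

theorem blockCoeff_div_factorial (ν : ι → ℕ+) {I : Finset ι} (hI : I.Nonempty) :
    blockCoeff ν I / (((blockIndex ν I)! : ℕ) : ℚ) =
      falling (∑ i ∈ I, (((ν i : ℕ) : ℤ) : ℚ)) (#I - 1) * (∏ i ∈ I, (((ν i : ℕ)! : ℕ) : ℚ))⁻¹ := by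
  have h1 := card_le_sum ν I
  have h2 := hI.card_pos
  have h3 := falling_natCast (n := ∑ i ∈ I, (ν i : ℕ)) (k := #I - 1) (by omega)
  have h4 : ∑ i ∈ I, (((ν i : ℕ) : ℤ) : ℚ) = ((∑ i ∈ I, (ν i : ℕ) : ℕ) : ℚ) := by push_cast; rfl
  rw [h4, h3, blockCoeff, blockIndex,
    show ∑ i ∈ I, (ν i : ℕ) - (#I - 1) = ∑ i ∈ I, (ν i : ℕ) + 1 - #I by omega]
  ring

theorem factorial_mul_abelProd (ν : ι → ℕ+) (n : ℕ) (A : Finset ι) :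
    (((n + 1 + ∑ i ∈ A, (ν i : ℕ) - #A)! : ℕ) : ℚ) *
      abelProd (fun i => (((ν i : ℕ) : ℤ) : ℚ)) ((n + 1 : ℕ) : ℤ) A =
    (n + 1) * (((n + ∑ i ∈ A, (ν i : ℕ))! : ℕ) : ℚ) := by
  have h1 := card_le_sum ν A
  rw [abelProd]
  split_ifs with h
  · rw [card_eq_zero.1 h]
    simp [Nat.factorial_succ]
  · have h3 := falling_natCast (n := n + ∑ i ∈ A, (ν i : ℕ)) (k := #A - 1) (by omega)
    have h4 : (((n + 1 : ℕ) : ℤ) : ℚ) - 1 + ∑ i ∈ A, (((ν i : ℕ) : ℤ) : ℚ) =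
        ((n + ∑ i ∈ A, (ν i : ℕ) : ℕ) : ℚ) := by push_cast; ring
    rw [h4, h3, show n + ∑ i ∈ A, (ν i : ℕ) - (#A - 1) = n + 1 + ∑ i ∈ A, (ν i : ℕ) - #A by omega]
    have : (((n + 1 + ∑ i ∈ A, (ν i : ℕ) - #A)! : ℕ) : ℚ) ≠ 0 := by positivity
    push_cast
    field_simp

variable [DecidableEq ι]

/-- The sum over partitions that describes products of the operators `dual`. -/
noncomputable def partitionSum (ν : ι → ℕ+) (C : ℤ) (s : Finset ι) : V :=
  ∑ π ∈ partitions s, divPow (C - #π - ∑ i ∈ s, ((ν i : ℕ) : ℤ)) *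
    ∏ I ∈ π, blockCoeff ν I • x (blockIndex ν I)

theorem sum_blockIndex_add_card (ν : ι → ℕ+) {A : Finset ι} {π : Finset (Finset ι)}
    (hπ : π ∈ partitions A) :
    ∑ I ∈ π, blockIndex ν I + #A = ∑ i ∈ A, (ν i : ℕ) + #π := by
  have h1 : #A = ∑ I ∈ π, #I := by
    simp only [card_eq_sum_ones]
    exact (sum_sum_of_mem_partitions hπ _).symm
  rw [h1, ← sum_add_distrib, sum_congr rfl fun I _ => blockIndex_add_card ν I, sum_add_distrib,
    sum_sum_of_mem_partitions hπ]
  simp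

theorem prod_blockCoeff_div_factorial (ν : ι → ℕ+) {A : Finset ι} {π : Finset (Finset ι)}
    (hπ : π ∈ partitions A) :
    ∏ I ∈ π, blockCoeff ν I / (((blockIndex ν I)! : ℕ) : ℚ) =
      (∏ I ∈ π, falling (∑ i ∈ I, (((ν i : ℕ) : ℤ) : ℚ)) (#I - 1)) *
        (∏ i ∈ A, (((ν i : ℕ)! : ℕ) : ℚ))⁻¹ := by
  rw [prod_congr rfl fun I hI => blockCoeff_div_factorial ν ((mem_partitions.1 hπ).1 I hI),
    prod_mul_distrib, prod_inv_distrib, prod_prod_of_mem_partitions hπ]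

/-- By `gen_mul_prod` the derivatives absorb a set `Q` of blocks, which merge with `a` into one new
block `insert a A`, where `A` is the union of `Q`. Summing over the ways to cut `A` into blocks
(`sum_partitions_falling`) produces exactly the multinomial coefficient of that block. -/
theorem gen_partitionSum (ν : ι → ℕ+) (C : ℤ) {a : ι} {s : Finset ι} (ha : a ∉ s) :
    (1 / ((((ν a : ℕ) + 1)! : ℕ) : ℚ)) • gen (ν a + 1) 0 (partitionSum ν C s) =
      partitionSum ν C (insert a s) := by
  set n : ℕ := (ν a : ℕ) with hn
  set σ : ℤ := ∑ i ∈ s, ((ν i : ℕ) : ℤ) with hσ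
  set P : Finset (Finset ι) → V := fun ρ => ∏ I ∈ ρ, blockCoeff ν I • x (blockIndex ν I) with hP
  set f : Finset (Finset ι) → Finset (Finset ι) → V := fun Q R =>
    (falling (n + 1 : ℕ) #Q * ∏ I ∈ Q, blockCoeff ν I / (((blockIndex ν I)! : ℕ) : ℚ)) •
      ((((n + 1 - #Q + ∑ I ∈ Q, blockIndex ν I)! : ℕ) : ℚ) •
        (x (n + 1 - #Q + ∑ I ∈ Q, blockIndex ν I - 1) *
          divPow (C - (#Q + #R : ℕ) - σ - (n + 1 - #Q : ℕ))) * P R) with hf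
  have h1 : ∀ π ∈ partitions s, gen (n + 1) 0 (divPow (C - #π - σ) * P π) =
      ∑ Q ∈ π.powerset, f Q (π \ Q) := by
    intro π _
    rw [hP, gen_mul_prod _ _ _ _ fun I _ => ?_]
    · refine sum_congr rfl fun Q hQ => ?_
      have hQ' := card_sdiff_add_card_eq_card (mem_powerset.1 hQ)
      rw [gen_divPow, zero_add, hf]
      simp only [hP, ← hQ', add_comm #(π \ Q)]
    · have := blockIndex_add_card ν I
      have := card_le_sum ν I
      omega
  have h2 : ∀ A ⊆ s, ∀ π ∈ partitions A, ∀ ρ ∈ partitions (s \ A), f π ρ =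
      (falling (n + 1 : ℕ) #π * ∏ I ∈ π, falling (∑ i ∈ I, (((ν i : ℕ) : ℤ) : ℚ)) (#I - 1)) •
        (((∏ i ∈ A, (((ν i : ℕ)! : ℕ) : ℚ))⁻¹ *
          (((n + 1 + ∑ i ∈ A, (ν i : ℕ) - #A)! : ℕ) : ℚ)) •
            (x (n + ∑ i ∈ A, (ν i : ℕ) - #A) * divPow (C - #ρ - σ - (n + 1 : ℕ)) * P ρ)) := by
    intro A hA π hπ ρ hρ
    -- With more than `n + 1` absorbed blocks the truncated index is wrong, but the falling
    -- factorial is zero.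
    by_cases hle : #π ≤ n + 1
    · have hidx := sum_blockIndex_add_card ν hπ
      rw [hf]
      simp only
      rw [prod_blockCoeff_div_factorial ν hπ, show n + 1 - #π + ∑ I ∈ π, blockIndex ν I =
        n + 1 + ∑ i ∈ A, (ν i : ℕ) - #A by omega,
        show n + 1 + ∑ i ∈ A, (ν i : ℕ) - #A - 1 = n + ∑ i ∈ A, (ν i : ℕ) - #A by omega,
        show C - (#π + #ρ : ℕ) - σ - (n + 1 - #π : ℕ) = C - #ρ - σ - (n + 1 : ℕ) by omega]
      rw [smul_mul_assoc, smul_smul, smul_smul]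
      congr 1
      ring
    · rw [hf]
      simp only
      rw [falling_natCast_eq_zero (by omega)]
      simp
  rw [partitionSum, map_sum, sum_congr rfl h1, sum_partitions_powerset, smul_sum, partitionSum,
    sum_partitions_insert ha]
  refine sum_congr rfl fun A hA => ?_
  have hA' := mem_powerset.1 hA
  have haA : a ∉ A := fun h => ha (hA' h)
  rw [sum_comm, smul_sum]
  refine sum_congr rfl fun ρ hρ => ?_
  rw [sum_congr rfl fun π hπ => h2 A hA' π hπ ρ hρ, ← sum_smul]
  have h3 := sum_partitions_falling (fun i => ((ν i : ℕ) : ℤ)) A ((n + 1 : ℕ) : ℤ)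
  rw [Int.cast_natCast] at h3
  have hmem := insert_notMem_of_mem_partitions ha hρ
  rw [h3, prod_insert hmem, card_insert_of_notMem hmem, sum_insert ha]
  have h4 : blockIndex ν (insert a A) = n + ∑ i ∈ A, (ν i : ℕ) - #A := by
    rw [blockIndex, sum_insert haA, card_insert_of_notMem haA]
    omega
  have h5 := factorial_mul_abelProd ν n A
  rw [h4, smul_smul, smul_smul, show C - (#ρ + 1 : ℕ) - (((ν a : ℕ) : ℤ) + σ) =
    C - #ρ - σ - (n + 1 : ℕ) by push_cast; ring]
  rw [smul_mul_assoc, mul_smul_comm, mul_assoc, mul_left_comm (divPow _)]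
  congr 1
  · rw [Int.cast_natCast] at h5
    rw [mul_left_comm (abelProd _ _ _), mul_comm (abelProd _ _ _), h5, blockCoeff,
      sum_insert haA, prod_insert haA, Nat.factorial_succ, ← hn]
    have : ((n ! : ℕ) : ℚ) ≠ 0 := by positivity
    have : ∏ i ∈ A, (((ν i : ℕ)! : ℕ) : ℚ) ≠ 0 := prod_ne_zero_iff.2 fun i _ => by positivity
    push_cast
    field_simp
  · rw [mul_assoc]

theorem partitionSum_empty (ν : ι → ℕ+) (C : ℤ) : partitionSum ν C ∅ = divPow C := by
  simp [partitionSum, partitions_empty]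

theorem fourierSum_eq_partitionSum (g n : ℕ) {k : ℕ} (ν : Fin k → ℕ+) :
    fourierSum g n ν = partitionSum ν ((g : ℤ) - n) univ := by
  rw [fourierSum, partitionSum, sum_partitions]
  refine sum_congr rfl fun P _ => ?_
  split_ifs with h
  · congr 1
    rw [← Nat.cast_sum, show (g : ℤ) - n - #P.parts - (∑ i, (ν i : ℕ) : ℕ) =
      (g - n - #P.parts - ∑ i, (ν i : ℕ) : ℕ) by omega, divPow_natCast]
    rfl
  · rw [← Nat.cast_sum, divPow_of_neg (by omega), zero_mul]

theorem prod_dual_divPow (g : ℕ) (ν : ι → ℕ+) (hν : ∀ i, ν i ≠ 1) (C : ℤ) (l : List ι)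
    (hl : l.Nodup) :
    (l.map fun i => dual g (ν i)).prod (divPow C) = partitionSum ν C l.toFinset := by
  induction l with
  | nil => simp [partitionSum_empty]
  | cons a l ih =>
    rw [List.nodup_cons] at hl
    rw [List.map_cons, List.prod_cons, Module.End.mul_apply, ih hl.2, dual_of_ne_one g (hν a),
      List.toFinset_cons, gen_partitionSum ν C (by simpa using hl.1)]

theorem fourierSum_eq (g n : ℕ) (l : List ℕ+) (hl : ∀ i ∈ l, i ≠ 1) :
    fourierSum g n l.get = (l.map (dual g)).prod (divPow ((g : ℤ) - n)) := by
  rw [fourierSum_eq_partitionSum]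
  have := prod_dual_divPow g l.get (fun i => hl _ (l.get_mem i)) ((g : ℤ) - n)
    (List.finRange l.length) (List.nodup_finRange _)
  rw [List.toFinset_finRange] at this
  rw [← this]
  congr 2
  exact (congrArg (List.map (dual g)) (List.map_get_finRange l)).symm.trans (List.map_map ..)
    |>.symm

theorem fourier_mono (g : ℕ) (m : ℕ+ →₀ ℕ) :
    fourier g (mono m) = ((-1 : ℚ) ^ m 1 * ((m 1)! : ℚ)) • fourierSum g (m 1) (higherIndices m).get := by
  have := (basisMonomials ℕ+ ℚ).constr_basis ℚ (fun m =>
    ((-1 : ℚ) ^ (m 1) * ((m 1) ! : ℚ)) • fourierSum g (m 1) (higherIndices m).get) m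
  rwa [coe_basisMonomials] at this

theorem coe_higherIndices_append (m : ℕ+ →₀ ℕ) :
    ((higherIndices m ++ List.replicate (m 1) 1 : List ℕ+) : Multiset ℕ+) =
      Finsupp.toMultiset m := by
  rw [← Multiset.coe_add, higherIndices, Multiset.sort_eq, Multiset.coe_replicate]
  conv_rhs => rw [← Multiset.filter_add_not (fun i : ℕ+ => 1 < i) (Finsupp.toMultiset m)]
  congr 1
  rw [← Finsupp.count_toMultiset, ← Multiset.filter_eq']
  refine Multiset.filter_congr fun i _ => ?_
  rw [not_lt, le_one_iff_eq_one]

/-- The dual operators commute, so any listing of the variables will do. Putting the copies of `x₁`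
last applies `D ^ m 1` to `x₁^[g]` first, which yields the sign, the factorial and the shifted
divided power in the definition of `S`. -/
theorem fourier_mono_eq (g : ℕ) (m : ℕ+ →₀ ℕ) (l : List ℕ+)
    (hl : (l : Multiset ℕ+) = Finsupp.toMultiset m) :
    fourier g (mono m) = (l.map (dual g)).prod (divPow g) := by
  have hperm : l.Perm (higherIndices m ++ List.replicate (m 1) 1) := by
    rw [← Multiset.coe_eq_coe, coe_higherIndices_append, hl]
  have hcomm : (l.map (dual g)).Pairwise Commute := by
    rw [List.pairwise_map]
    exact List.pairwise_of_forall fun j k => LinearMap.ext fun F => dual_comm g j k F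
  rw [(hperm.map (dual g)).prod_eq' hcomm, List.map_append, List.prod_append, List.map_replicate,
    List.prod_replicate, Module.End.mul_apply, dual_one, D_pow_divPow, map_smul, fourier_mono,
    fourierSum_eq]
  intro i hi
  rw [higherIndices, Multiset.mem_sort, Multiset.mem_filter] at hi
  exact hi.2.ne'

theorem fourier_one (g : ℕ) : fourier g 1 = divPow g := by
  rw [← mono_zero, fourier_mono_eq g 0 [] (by simp)]
  simp

theorem fourier_X_mul (g : ℕ) (k : ℕ+) (F : V) :
    fourier g (X k * F) = dual g k (fourier g F) := by
  have hF : F ∈ Submodule.span ℚ (mono '' Set.univ) := mem_span_mono fun _ _ => Set.mem_univ _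
  induction hF using Submodule.span_induction with
  | mem F hF =>
    obtain ⟨m, -, rfl⟩ := hF
    have h := (Multiset.coe_toList (Finsupp.toMultiset m))
    rw [← mono_single_add, fourier_mono_eq g m _ h, fourier_mono_eq g _ (k :: _) ?_,
      List.map_cons, List.prod_cons, Module.End.mul_apply]
    rw [← Multiset.cons_coe, h]
    simp
  | zero => simp
  | add F G _ _ hF hG => rw [mul_add, map_add, hF, hG, map_add, map_add]
  | smul c F _ hF => rw [mul_smul_comm, map_smul, hF, map_smul, map_smul]

end FourierFormula

/-! ### Descent of `S` to the quotient, and `S⁴ = 1` there -/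

section Descent

theorem fourier_raise_sub_mem (g : ℕ) (k : ℕ+) (F : V) :
    fourier g (raise g k F) - lower g k (fourier g F) ∈ relations g := by
  induction F using induction_X_mul with
  | hadd F G hF hG =>
    simp only [map_add]
    rw [add_sub_add_comm]
    exact add_mem hF hG
  | hsmul r F hF =>
    simp only [map_smul, ← smul_sub]
    exact Submodule.smul_mem _ _ hF
  | one =>
    by_cases hk : k = 1
    · rw [raise, lower, if_pos hk, if_pos hk, weightOp_one, LinearMap.neg_apply, map_neg, map_smul,
        fourier_one, (isBihom_divPow g).weightOp]
      simp
    · have := one_lt_of_ne_one hk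
      rw [raise, lower, if_neg hk, if_neg hk, LinearMap.smul_apply, LinearMap.neg_apply,
        LinearMap.smul_apply, gen_succ_one, smul_zero, map_zero, zero_sub, neg_neg, fourier_one]
      refine Submodule.smul_mem _ _ ?_
      have hb := (isBihom_divPow g).gen (a := k) (b := 1) (by omega)
      rw [Nat.cast_one, sub_self, add_zero] at hb
      -- Here `gen k 1` preserves the degree `g` of `x₁^[g]` and lands in `higher`, so the result is
      -- a relation.
      exact hb.D_pow_mem_relations (gen_mem_higher _ _ _ (by omega)) 0
  | X_mul j F ih =>
    have hk := k.pos
    have hj := j.pos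
    obtain ⟨l, hl⟩ : ∃ l : ℕ+, (l : ℕ) + 1 = k + j :=
      ⟨⟨(k : ℕ) + j - 1, by omega⟩, by simp; omega⟩
    rw [raise_X_mul g hl, map_add, map_smul, fourier_X_mul, fourier_X_mul, fourier_X_mul,
      lower_dual g hl, add_sub_add_right_eq_sub, ← map_sub]
    exact dual_mem_relations j ih

/-- Induction on `F`: commuting `D` past `X k` produces `raise`, commuting `x₁` past `dual g k`
produces `lower`, and `fourier_raise_sub_mem` matches the two. At `F = 1` the error is `x₁ *
x₁^[g]`, of degree `g + 1`. -/
theorem fourier_D_sub_mem (g : ℕ) (F : V) :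
    fourier g (D g F) - X 1 * fourier g F ∈ relations g := by
  induction F using induction_X_mul with
  | hadd F G hF hG =>
    simp only [map_add, mul_add]
    rw [add_sub_add_comm]
    exact add_mem hF hG
  | hsmul r F hF =>
    simp only [map_smul, mul_smul_comm, ← smul_sub]
    exact Submodule.smul_mem _ _ hF
  | one =>
    rw [D_one, map_zero, zero_sub, fourier_one]
    exact neg_mem (((isBihom_divPow g).X_mul 1).mem_relations (by simp))
  | X_mul k F ih =>
    rw [D_X_mul_eq_raise, map_add, fourier_X_mul, fourier_X_mul, X_one_mul_dual,
      add_sub_add_comm, ← map_sub]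
    exact add_mem (dual_mem_relations k ih) (fourier_raise_sub_mem g k F)

/-- `S` exchanges the two gradings up to reflection in `g`; hence it kills everything of degree `>
g`, the number of factors of the image being negative. -/
theorem isBihom_fourier_mono (g : ℕ) (m : ℕ+ →₀ ℕ) : IsBihom (fourier g (mono m))
    (g - (m.degree : ℕ)) (g - (Finsupp.weight deg m : ℕ)) := by
  induction m using monomial_induction with
  | zero => rw [mono_zero, fourier_one]; simpa using isBihom_divPow g
  | single_add n m ih =>
    rw [mono_single_add, fourier_X_mul]
    convert ih.dual g n using 1 <;> simp [Finsupp.weight_single, deg] <;> ring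

theorem IsBihom.fourier_eq_zero {g : ℕ} {F : V} {p r : ℤ} (h : IsBihom F p r)
    (hp : (g : ℤ) < p) : fourier g F = 0 := by
  have : F ∈ LinearMap.ker (fourier g) := by
    refine Submodule.span_le.2 ?_ h.mem_span
    rintro _ ⟨m, ⟨h1, -⟩, rfl⟩
    exact (isBihom_fourier_mono g m).eq_zero_of_neg (Or.inr (by omega))
  exact this

theorem fourier_mem_relations {g : ℕ} {F : V} (hF : F ∈ relations g) :
    fourier g F ∈ relations g := by
  refine relations_le (T := (relations g).comap (fourier g)) (fun d F p r h hp => ?_) hF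
  rw [Submodule.mem_comap]
  induction d with
  | zero => simp [h.fourier_eq_zero hp]
  | succ d ih =>
    rw [pow_succ', Module.End.mul_apply]
    have := add_mem (fourier_D_sub_mem g ((D g ^ d) F)) (X_mul_mem_relations 1 ih)
    rwa [sub_add_cancel] at this

/-- `S` acts like the rotation that exchanges the two plane coordinates up to sign. The case `a = 0`
is `fourier_X_mul`; raising `a` uses `[D, gen a (b + 1)] = (b + 1) • gen (a + 1) b` on one side and
the commutator of `gen (b + 1) a` with `x₁` on the other. -/
theorem fourier_gen_sub_mem (g a b : ℕ) (hab : 3 ≤ a + b) (F : V) :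
    fourier g (gen a b F) - (-1 : ℚ) ^ a • gen b a (fourier g F) ∈ relations g := by
  induction a generalizing b F with
  | zero =>
    obtain ⟨k, rfl⟩ : ∃ k : ℕ+, b = k + 1 := ⟨⟨b - 1, by omega⟩, by simp; omega⟩
    have hk : k ≠ 1 := by rintro rfl; simp at hab
    rw [gen_zero_succ, map_smul, fourier_X_mul, dual_of_ne_one g hk, smul_smul,
      mul_one_div_cancel (by positivity)]
    simp
  | succ a ih =>
    have hab' : 3 ≤ a + (b + 1) := by omega
    have h1 := D_gen g hab' F
    rw [← sub_eq_iff_eq_add', Nat.add_sub_cancel] at h1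
    have h2 := gen_X_mul (b + 1) a 1 (fourier g F)
    rw [← sub_eq_iff_eq_add'] at h2
    simp only [PNat.one_coe, Nat.factorial_one, Nat.cast_one, div_one, Nat.add_sub_cancel] at h2
    have hb : ((b + 1 : ℕ) : ℚ) ≠ 0 := by positivity
    have key : ((b + 1 : ℕ) : ℚ) •
        (fourier g (gen (a + 1) b F) - (-1 : ℚ) ^ (a + 1) • gen b (a + 1) (fourier g F)) =
        (fourier g (D g (gen a (b + 1) F)) - X 1 * fourier g (gen a (b + 1) F)) +
        X 1 * (fourier g (gen a (b + 1) F) - (-1 : ℚ) ^ a • gen (b + 1) a (fourier g F)) -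
        (fourier g (gen a (b + 1) (D g F)) - (-1 : ℚ) ^ a • gen (b + 1) a (fourier g (D g F))) -
        (-1 : ℚ) ^ a • gen (b + 1) a (fourier g (D g F) - X 1 * fourier g F) := by
      have h1' := congrArg (fourier g) h1
      rw [map_sub, map_smul] at h1'
      rw [smul_sub, ← h1', smul_comm, ← h2]
      simp only [map_sub, mul_sub, mul_smul_comm, smul_sub, pow_succ]
      module
    have hmem : ((b + 1 : ℕ) : ℚ) •
        (fourier g (gen (a + 1) b F) - (-1 : ℚ) ^ (a + 1) • gen b (a + 1) (fourier g F)) ∈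
        relations g := by
      rw [key]
      refine sub_mem (sub_mem (add_mem (fourier_D_sub_mem g _) (X_mul_mem_relations 1 ?_)) ?_) ?_
      · exact ih _ hab' _
      · exact ih _ hab' _
      · exact Submodule.smul_mem _ _ (gen_mem_relations (by omega) (fourier_D_sub_mem g _))
    have := Submodule.smul_mem _ ((b + 1 : ℕ) : ℚ)⁻¹ hmem
    rwa [inv_smul_smul₀ hb] at this

theorem fourier_dual_sub_mem (g : ℕ) (k : ℕ+) (F : V) :
    fourier g (dual g k F) - (-1 : ℚ) ^ ((k : ℕ) + 1) • (X k * fourier g F) ∈ relations g := by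
  by_cases hk : k = 1
  · subst hk
    rw [dual_one]
    simpa using fourier_D_sub_mem g F
  · have h1 := one_lt_of_ne_one hk
    have := fourier_gen_sub_mem g (k + 1) 0 (by omega) F
    rw [gen_zero_succ] at this
    have := Submodule.smul_mem _ (((k : ℕ) + 1)! : ℚ)⁻¹ this
    rw [smul_sub, smul_comm, inv_smul_smul₀ (by positivity)] at this
    rwa [dual_of_ne_one g hk, map_smul, one_div]

theorem fourier_divPow (g : ℕ) : fourier g (divPow g) = (-1 : ℚ) ^ g • 1 := by
  have : ∀ n, fourier g (X 1 ^ n) = (D g ^ n) (divPow g) := by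
    intro n
    induction n with
    | zero => simpa using fourier_one g
    | succ n ih => rw [pow_succ', fourier_X_mul, ih, dual_one, pow_succ', Module.End.mul_apply]
  rw [divPow_natCast, map_smul, this, D_pow_divPow, sub_self, smul_smul]
  have h0 : divPow 0 = 1 := by simp [divPow]
  rw [h0]
  congr 1
  have : (g ! : ℚ) ≠ 0 := by positivity
  field_simp

/-- The operator on a quotient by an ideal induced by an operator that preserves the ideal. -/
noncomputable def descend {J : Ideal V} (A : Module.End ℚ V) (h : ∀ F ∈ J, A F ∈ J) :
    Module.End ℚ (V ⧸ J) :=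
  (Submodule.liftQ (J.restrictScalars ℚ) ((Ideal.Quotient.mkₐ ℚ J).toLinearMap ∘ₗ A)
    (fun F hF => Ideal.Quotient.eq_zero_iff_mem.2 (h F hF))) ∘ₗ
    (Submodule.Quotient.restrictScalarsEquiv ℚ J).symm.toLinearMap

theorem descend_mk {J : Ideal V} (A : Module.End ℚ V) (h : ∀ F ∈ J, A F ∈ J) (F : V) :
    descend A h (Ideal.Quotient.mk J F) = Ideal.Quotient.mk J (A F) := rfl

/-- The operator induced by the Fourier transform on the quotient by the relations. -/
noncomputable def fourierQuot (g : ℕ) : Module.End ℚ (V ⧸ relationsIdeal g) :=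
  descend (fourier g) fun _ hF =>
    mem_relationsIdeal.2 (fourier_mem_relations (mem_relationsIdeal.1 hF))

theorem fourierQuot_mk (g : ℕ) (F : V) : fourierQuot g (Ideal.Quotient.mk _ F) =
    Ideal.Quotient.mk _ (fourier g F) := rfl

theorem mk_smul {J : Ideal V} (c : ℚ) (F : V) :
    Ideal.Quotient.mk J (c • F) = c • Ideal.Quotient.mk J F := rfl

theorem mk_fourier_dual (g : ℕ) (k : ℕ+) (F : V) :
    Ideal.Quotient.mk (relationsIdeal g) (fourier g (dual g k F)) =
    (-1 : ℚ) ^ ((k : ℕ) + 1) • Ideal.Quotient.mk _ (X k * fourier g F) := by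
  rw [← mk_smul]
  exact Ideal.Quotient.eq.2 (fourier_dual_sub_mem g k F)

/-- `S²` sends `1` to `(-1)^g` and commutes with `x_k` up to `(-1)^(k+1)`; both signs square to one.
-/
theorem fourierQuot_four (g : ℕ) (u : V ⧸ relationsIdeal g) :
    fourierQuot g (fourierQuot g (fourierQuot g (fourierQuot g u))) = u := by
  obtain ⟨F, rfl⟩ := Ideal.Quotient.mk_surjective u
  induction F using induction_X_mul with
  | hadd F G hF hG => simp only [map_add, hF, hG]
  | hsmul r F hF => simp only [mk_smul, map_smul, hF]
  | one =>
    simp only [fourierQuot_mk, fourier_one, fourier_divPow, map_smul, mk_smul, smul_smul]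
    rw [← mul_pow]
    simp
  | X_mul k F ih =>
    simp only [fourierQuot_mk] at ih ⊢
    rw [fourier_X_mul, ← fourierQuot_mk, ← fourierQuot_mk, mk_fourier_dual, map_smul, map_smul,
      fourierQuot_mk, fourier_X_mul, fourierQuot_mk, mk_fourier_dual, smul_smul, ← mul_pow,
      map_mul, ih, ← map_mul]
    simp

/-- The Fourier transform as an automorphism of the quotient by the relations. -/
noncomputable def fourierEquiv (g : ℕ) : (V ⧸ relationsIdeal g) ≃ₗ[ℚ] (V ⧸ relationsIdeal g) :=
  LinearEquiv.ofLinearMap (fourierQuot g) (fourierQuot g ∘ₗ fourierQuot g ∘ₗ fourierQuot g)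
    (LinearMap.ext (fourierQuot_four g)) (LinearMap.ext (fourierQuot_four g))

theorem fourierEquiv_mk (g : ℕ) (F : V) : fourierEquiv g (Ideal.Quotient.mk _ F) =
    Ideal.Quotient.mk _ (fourier g F) := rfl

theorem Dk_mem_relations {g k : ℕ} (hk : 3 ≤ k) {F : V} (hF : F ∈ relations g) :
    Dk k F ∈ relations g := by
  rw [Dk_eq]
  exact Submodule.smul_mem _ _ (gen_mem_relations (by omega) hF)

/-- The operator induced by `Dk k` on the quotient by the relations, for `k ≥ 3`. -/
noncomputable def dkQuot (g k : ℕ) : Module.End ℚ (V ⧸ relationsIdeal g) :=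
  if hk : 3 ≤ k then descend (Dk k) fun _ hF =>
    mem_relationsIdeal.2 (Dk_mem_relations hk (mem_relationsIdeal.1 hF)) else 0

theorem dkQuot_mk {g k : ℕ} (hk : 3 ≤ k) (F : V) :
    dkQuot g k (Ideal.Quotient.mk _ F) = Ideal.Quotient.mk _ (Dk k F) := by
  rw [dkQuot, dif_pos hk, descend_mk]

end Descent
end JacTaut

theorem theorem4 (g : ℕ) (hg : 2 ≤ g) :
    -- the operator `D` is `D₂ - g ∂₁`
    JacTaut.D g = JacTaut.Dk 2 - (g : ℚ) • JacTaut.partialOne ∧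
    -- `[D_k, D] = 0` on `ℚ[x₁, x₂, …]` for `k ≥ 3`
    (∀ k : ℕ, 3 ≤ k → ⁅JacTaut.Dk k, JacTaut.D g⁆ = 0) ∧
    -- `I_g` is an ideal `J`, so that `R = ℚ[x₁, x₂, …] / I_g` is a commutative ring
    ∃ J : Ideal JacTaut.V, J.restrictScalars ℚ = JacTaut.relations g ∧
      -- `S` and the `D_k` with `k ≥ 3` descend to `R`, and `S` becomes invertible there
      ∃ (S : (JacTaut.V ⧸ J) ≃ₗ[ℚ] (JacTaut.V ⧸ J)) (E : ℕ → Module.End ℚ (JacTaut.V ⧸ J)),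
        (∀ F : JacTaut.V,
          S (Ideal.Quotient.mk J F) = Ideal.Quotient.mk J (JacTaut.fourier g F)) ∧
        (∀ k : ℕ, 3 ≤ k → ∀ F : JacTaut.V,
          E k (Ideal.Quotient.mk J F) = Ideal.Quotient.mk J (JacTaut.Dk k F)) ∧
        -- `S(p_k · S⁻¹ F) = D_{k+1}(F)` on `R`, with `p_k` the class of `x_k`
        ∀ k : ℕ, 2 ≤ k → ∀ F : JacTaut.V ⧸ J,
          S (Ideal.Quotient.mk J (JacTaut.x k) * S.symm F) = E (k + 1) F := by
  refine ⟨JacTaut.D_eq g, fun k hk => ?_, JacTaut.relationsIdeal g, rfl, JacTaut.fourierEquiv g,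
    JacTaut.dkQuot g, fun F => rfl, fun k hk F => JacTaut.dkQuot_mk hk F, fun k hk F => ?_⟩
  · rw [Ring.lie_def, sub_eq_zero]
    refine LinearMap.ext fun F => ?_
    -- `D` is `dual g 1`, so this is a case of the commutation with the dual operators.
    have := JacTaut.gen_dual_comm g hk 1 F
    rw [JacTaut.dual_one] at this
    simp only [Module.End.mul_apply, JacTaut.Dk_eq, LinearMap.smul_apply, map_smul, this]
  -- Writing `F` as `S u` turns the claim into `S (x_k u) = dual_k (S u)`, which holds on
  -- representatives in `V`.
  · obtain ⟨u, rfl⟩ := (JacTaut.fourierEquiv g).surjective F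
    obtain ⟨F, rfl⟩ := Ideal.Quotient.mk_surjective u
    lift k to ℕ+ using by omega
    have hk1 : k ≠ 1 := by rintro rfl; simp at hk
    rw [LinearEquiv.symm_apply_apply, ← map_mul, JacTaut.x_coe]
    rw [JacTaut.fourierEquiv_mk, JacTaut.fourierEquiv_mk, JacTaut.dkQuot_mk (by omega),
      JacTaut.fourier_X_mul, JacTaut.dual, if_neg hk1]
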